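/- Let $d\ge 1$, $0<\alpha<d$, and let $k(x)=|x|^{-(d-\alpha)}$ be the Riesz kernel on $\mathbb R^d$ (with $k(0)=+\infty$), where $|\cdot|$ is the Euclidean norm. Put $W(x,y)=k(x-y)$. Let $\mu_\star$ be a probability measure on $\mathbb R^d$ with a density $f_\star\in L^p(\mathbb R^d)$ for some $d/\alpha<p\le\infty$, and let $R>0$ be such that the support of $\mu_\star$ is contained in the closed ball $\{|x|\le R\}$. Let $U(x)=\int k(x-y)\,d\mu_\star(y)$ be the Riesz potential of $\mu_\star$, and define $$V(x)=-U(x)+\big[|x|^2-R^2\big]_+ ,\qquad x\in\mathbb R^d .$$ Let $\mathcal M_1$ be the set of probability measures on $\mathbb R^d$ with the topology of weak convergence. Then $U$ is finite everywhere, and: 1. The pair $(V,W)$ satisfies the following four conditions. - (H1) $W:\mathbb R^d\times\mathbb R^d\to(-\infty,+\infty]$ is continuous, symmetric, finite off the diagonal, and for every compact $K\subset\mathbb R^d$ the function $z\mapsto\sup\{W(x,y): x,y\in K,\ |x-y|\ge|z|\}$ is locally Lebesgue integrable on $\mathbb R^d$ (with value $0$ where the supremum is over the empty set). - (H2) $V:\mathbb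 R^d\to\mathbb R$ is continuous, $V(x)\to+\infty$ as $|x|\to\infty$, and $\int_{\mathbb R^d}e^{-V(x)}\,dx<\infty$. - (H3) There are $c\in\mathbb R$ and $\varepsilon\in(0,1)$ such that $W(x,y)\ge c-\varepsilon\,(V(x)+V(y))$ for all $x,y\in\mathbb R^d$. - (H4) For every $\nu\in\mathcal M_1$ with $E(\nu)<\infty$, where $E(\nu)=\frac12\iint\big(V(x)+V(y)+W(x,y)\big)\,d\nu(x)\,d\nu(y)$, there are probability measures $\nu_n$, absolutely continuous with respect to Lebesgue measure, with $\nu_n\to\nu$ weakly and $E(\nu_n)\to E(\nu)$. 2. The functional $$I(\nu)=\int V\,d\nu+\tfrac12\iint k(x-y)\,d\nu(x)\,d\nu(y),\qquad \nu\in\mathcal M_1,$$ takes its values in $\mathbb R\cup\{+\infty\}$, coincides with $E$, and has $\mu_\star$ as its unique minimizer over $\mathcal M_1$. 3. Let $(\beta_N)$ be a sequence of real numbers with $\beta_N\gg N\log N$, that is, $\beta_N/(N\log N)\to+\infty$ as $N\to\infty$. For $N\ge1$ let $$H_N(x_1,\dots,x_N)=\frac1N\sum_{i=1}^N V(x_i)+\frac1{N^2}\sum_{1\le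 i<j\le N}W(x_i,x_j),\qquad Z_N=\int_{(\mathbb R^d)^N}e^{-\beta_NH_N}\,dx_1\cdots dx_N .$$ Then $0<Z_N<\infty$ for all large $N$. For such $N$ let $P_N$ be the probability measure $Z_N^{-1}e^{-\beta_NH_N}\,dx_1\cdots dx_N$ on $(\mathbb R^d)^N$. If, on one and the same probability space, $X^{N}=(X^{N}_1,\dots,X^{N}_N)$ are random vectors such that $X^{N}$ has law $P_N$ for all large $N$ (with arbitrary dependence between different $N$), then almost surely the empirical measures $\mu_N=\frac1N\sum_{i=1}^N\delta_{X^{N}_i}$ converge weakly to $\mu_\star$ as $N\to\infty$. -/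

import Mathlib

open MeasureTheory ProbabilityTheory Filter Topology
open scoped NNReal ENNReal

noncomputable section

namespace RieszGas

/-- The Euclidean space `ℝ^d`, with Euclidean norm and Lebesgue measure `volume`. -/
abbrev Rd (d : ℕ) : Type := EuclideanSpace ℝ (Fin d)

/-- The integral of an extended-real-valued function, as the integral of its positive part minus
the integral of its negative part. It is meaningful as soon as one of the two is finite (for
instance for a function bounded from below and a finite measure); `∞ - ∞` gets the value `⊥`. -/
def extIntegral {Ω : Type*} [MeasurableSpace Ω] (μ : Measure Ω) (f : Ω → EReal) : EReal :=
  ((∫⁻ x, (f x).toENNReal ∂μ : ℝ≥0∞) : EReal) - ((∫⁻ x, (-f x).toENNReal ∂μ : ℝ≥0∞) : EReal)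

/-! ### A gas with confinement potential `V` and pair interaction `W` -/

/-- The functional `I(μ) = (1/2) ∬ (V(x) + V(y) + W(x,y)) dμ(x) dμ(y)`. -/
def energy {d : ℕ} (V : Rd d → ℝ) (W : Rd d → Rd d → EReal)
    (μ : ProbabilityMeasure (Rd d)) : EReal :=
  ((1 / 2 : ℝ) : EReal) *
    extIntegral ((μ : Measure (Rd d)).prod (μ : Measure (Rd d)))
      (fun q => (V q.1 : EReal) + (V q.2 : EReal) + W q.1 q.2)

/-- The function `z ↦ sup {W(x,y) : |x - y| ≥ |z|, x, y ∈ K}`. When `W` is continuous and finite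
off the diagonal, and `K` is compact, the supremum is a real number for every `z ≠ 0` with
`|z| ≤ diam K`, so nothing is lost in `toReal`; for `|z| > diam K` it is over the empty set, and
the value is `0`. -/
def offDiagSup {d : ℕ} (W : Rd d → Rd d → EReal) (K : Set (Rd d)) (z : Rd d) : ℝ :=
  (sSup {w : EReal | ∃ x ∈ K, ∃ y ∈ K, ‖z‖ ≤ ‖x - y‖ ∧ w = W x y}).toReal

/-- (H1): `W : ℝ^d × ℝ^d → (-∞, +∞]` is continuous, symmetric, finite off the diagonal, and
satisfies the local integrability condition. -/
structure InteractionRegular {d : ℕ} (W : Rd d → Rd d → EReal) : Prop where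
  ne_bot : ∀ x y, W x y ≠ ⊥
  continuous : Continuous (fun q : Rd d × Rd d => W q.1 q.2)
  symm : ∀ x y, W x y = W y x
  finite_off_diag : ∀ x y, x ≠ y → W x y ≠ ⊤
  locallyIntegrable_sup : ∀ K : Set (Rd d), IsCompact K →
    LocallyIntegrable (offDiagSup W K) volume

/-- (H2): `V` is continuous, tends to `+∞` at infinity, and `exp (-V)` is integrable. -/
structure Confining {d : ℕ} (V : Rd d → ℝ) : Prop where
  continuous : Continuous V
  tendsto_atTop : Tendsto V (cocompact (Rd d)) atTop
  integrable_exp_neg : Integrable (fun x => Real.exp (-V x)) volume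

/-- (H3): `W(x,y) ≥ c - ε (V(x) + V(y))` for constants `c ∈ ℝ` and `ε ∈ (0,1)`. -/
def Dominates {d : ℕ} (V : Rd d → ℝ) (W : Rd d → Rd d → EReal) : Prop :=
  ∃ c ε : ℝ, 0 < ε ∧ ε < 1 ∧ ∀ x y, ((c - ε * (V x + V y) : ℝ) : EReal) ≤ W x y

/-- (H4): every probability measure of finite energy is the weak limit of absolutely continuous
probability measures whose energies converge to its energy. -/
def EnergyApproximable {d : ℕ} (V : Rd d → ℝ) (W : Rd d → Rd d → EReal) : Prop :=
  ∀ ν : ProbabilityMeasure (Rd d), energy V W ν < ⊤ →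
    ∃ νs : ℕ → ProbabilityMeasure (Rd d),
      (∀ n, (νs n : Measure (Rd d)) ≪ volume) ∧
      Tendsto νs atTop (𝓝 ν) ∧
      Tendsto (fun n => energy V W (νs n)) atTop (𝓝 (energy V W ν))

/-- `H_N(x_1, …, x_N) = (1/N) ∑_i V(x_i) + (1/N²) ∑_{i<j} W(x_i, x_j)`, for `N ≥ 1`. -/
def hamiltonian {d : ℕ} (V : Rd d → ℝ) (W : Rd d → Rd d → EReal) (N : ℕ)
    (x : Fin N → Rd d) : EReal :=
  (((1 / (N : ℝ)) * ∑ i, V (x i) : ℝ) : EReal) +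
    ((1 / (N : ℝ) ^ 2 : ℝ) : EReal) * ∑ i, ∑ j ∈ Finset.univ.filter (fun j => i < j), W (x i) (x j)

/-- `exp (-β H_N)`, with `exp (-∞) = 0`. -/
def boltzmannWeight {d : ℕ} (V : Rd d → ℝ) (W : Rd d → Rd d → EReal) (β : ℝ) (N : ℕ)
    (x : Fin N → Rd d) : ℝ≥0∞ :=
  EReal.exp (-((β : EReal) * hamiltonian V W N x))

/-- `Z_N`, the integral of `exp (-β H_N)` for the Lebesgue measure on `(ℝ^d)^N`. -/
def partitionFunction {d : ℕ} (V : Rd d → ℝ) (W : Rd d → Rd d → EReal) (β : ℝ) (N : ℕ) : ℝ≥0∞ :=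
  ∫⁻ x, boltzmannWeight V W β N x

/-- The Boltzmann-Gibbs measure `dP_N = Z_N⁻¹ exp (-β H_N) dx_1 … dx_N` (a probability measure
when `0 < Z_N < ∞`). -/
def gibbsMeasure {d : ℕ} (V : Rd d → ℝ) (W : Rd d → Rd d → EReal) (β : ℝ) (N : ℕ) :
    Measure (Fin N → Rd d) :=
  (partitionFunction V W β N)⁻¹ • (volume.withDensity (boltzmannWeight V W β N))

/-- The Dirac mass `δ_x` as a finite measure. -/
def diracFiniteMeasure {d : ℕ} (x : Rd d) : FiniteMeasure (Rd d) :=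
  ⟨Measure.dirac x, inferInstance⟩

/-- The empirical measure `(1/N) ∑_i δ_{x_i}`, for `N ≥ 1` a probability measure (and `0` for
`N = 0`). Finite measures carry the topology of weak convergence. -/
def empiricalMeasure {d N : ℕ} (x : Fin N → Rd d) : FiniteMeasure (Rd d) :=
  ((N : ℝ≥0)⁻¹) • ∑ i, diracFiniteMeasure (x i)

/-! ### Riesz interactions -/

/-- The Riesz kernel `k(x) = 1 / |x|^(d-α)`, with `k(0) = +∞` for `α < d`. -/
def rieszKernel {d : ℕ} (α : ℝ) (x : Rd d) : ℝ≥0∞ := 1 / ‖x‖ₑ ^ ((d : ℝ) - α)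

/-- The Riesz interaction `W(x,y) = k(x - y)`. -/
def rieszInteraction {d : ℕ} (α : ℝ) (x y : Rd d) : EReal := (rieszKernel α (x - y) : EReal)

/-- The Riesz potential `U(x) = ∫ k(x - y) dμ(y)`. -/
def rieszPotential {d : ℕ} (α : ℝ) (μ : Measure (Rd d)) (x : Rd d) : ℝ≥0∞ :=
  ∫⁻ y, rieszKernel α (x - y) ∂μ

/-- The confinement potential `V(x) = -U(x) + [|x|² - R²]_+`. -/
def prescribingPotential {d : ℕ} (α R : ℝ) (μ : Measure (Rd d)) (x : Rd d) : ℝ :=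
  -(rieszPotential α μ x).toReal + max (‖x‖ ^ 2 - R ^ 2) 0

/-- The functional `I(μ) = ∫ V dμ + (1/2) ∬ k(x - y) dμ(x) dμ(y)`. -/
def rieszEnergy {d : ℕ} (α : ℝ) (V : Rd d → ℝ) (μ : ProbabilityMeasure (Rd d)) : EReal :=
  extIntegral (μ : Measure (Rd d)) (fun x => (V x : EReal)) +
    ((1 / 2 : ℝ) : EReal) *
      ((∫⁻ x, ∫⁻ y, rieszKernel α (x - y) ∂(μ : Measure (Rd d)) ∂(μ : Measure (Rd d)) : ℝ≥0∞) :
        EReal)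

end RieszGas

end

/-! Two properties of the Riesz kernel `k` carry the proof.

The first is regularity of `U`. Since `p > d/α`, a finite exponent `r > d/α` is available, and its
conjugate `q` satisfies `(d - α) q < d`, so `k^q` is integrable near the origin. Hölder's inequality
then makes the contribution of `|x - y| < δ` to `U(x)` small uniformly in `x`, so `U` is bounded and
continuous (`rieszPotential_bounded_continuous`). Consequently `|x|² - C ≤ V ≤ |x|²` and `V + B ≥
0`. Energies are shifted by `B` and handled in `[0, ∞]`, where an inequality between differences is
proved by moving terms to the other side.

The second is positive definiteness. By the Gamma integral, `k` is a positive mixture of Gaussians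
(`rieszKernel_eq_lintegral`), whose mutual energies are Fourier integrals of characteristic
functions (`gaussEnergy_fourier`). Hence `E(μ,μ) + E(ν,ν) - 2 E(μ,ν) ≥ 0`, where equality forces `μ
= ν` if the mutual energy is finite (`eq_of_pairEnergy_add_le`), and convolution with a probability
measure never raises the self-energy (`pairEnergy_conv_le`).

The potential is chosen so that `V + U = [|x|² - R²]_+`, which is nonnegative and vanishes on the
support of `μ`. Expanding the energy, `I(ν) - I(μ) = ∫ [|x|² - R²]_+ dν + ½ (E(ν,ν) + E(μ,μ) - 2
E(ν,μ))`, so `μ` is the unique minimizer. For (H4), measures are mollified: dominated convergence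
handles `∫ V`, while the interaction cannot increase under convolution and is lower semicontinuous.

For the gas, write `j` for the shifted minimum. Sampling points independently from a measure of
bounded density and nearly minimal energy bounds `Z_N` below by about `e^{-β_N (j + δ - B)} C^{-N}`;
conversely the weight of configurations with shifted Hamiltonian at least `j + 2δ` is at most about
`e^{-β_N (j + 2δ - B)} C^N`. As `β_N / N → ∞`, the gain `e^{-β_N δ}` beats every `C^N`
(`gibbsMeasure_le`). The resulting probabilities are summable, and Borel-Cantelli applies whatever
the coupling between different `N`. A deterministic compactness argument then concludes
(`tendsto_empiricalMeasure_of_shiftedHamiltonian_le`). -/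

noncomputable section

namespace RieszGas

/-! ### The Riesz kernel -/

lemma rieszKernel_neg {d : ℕ} (α : ℝ) (x : Rd d) : rieszKernel α (-x) = rieszKernel α x := by
  simp [rieszKernel]

lemma rieszKernel_sub_comm {d : ℕ} (α : ℝ) (x y : Rd d) :
    rieszKernel α (x - y) = rieszKernel α (y - x) := by
  rw [← rieszKernel_neg, neg_sub]

lemma rieszKernel_zero {d : ℕ} {α : ℝ} (hαd : α < d) : rieszKernel α (0 : Rd d) = ∞ := by
  simp [rieszKernel, ENNReal.zero_rpow_of_pos (sub_pos.2 hαd)]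

lemma rieszKernel_eq_ofReal {d : ℕ} (α : ℝ) {x : Rd d} (hx : x ≠ 0) :
    rieszKernel α x = ENNReal.ofReal (‖x‖ ^ (-((d : ℝ) - α))) := by
  rw [rieszKernel, one_div, ← ENNReal.rpow_neg, ← ofReal_norm,
    ENNReal.ofReal_rpow_of_pos (norm_pos_iff.2 hx)]

lemma rieszKernel_ne_top {d : ℕ} (α : ℝ) {x : Rd d} (hx : x ≠ 0) : rieszKernel α x ≠ ∞ := by
  rw [rieszKernel_eq_ofReal α hx]
  exact ENNReal.ofReal_ne_top

lemma continuous_rieszKernel {d : ℕ} (α : ℝ) :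
    Continuous (rieszKernel α : Rd d → ℝ≥0∞) := by
  unfold rieszKernel
  simp only [one_div]
  exact continuous_inv.comp (ENNReal.continuous_rpow_const.comp continuous_enorm)

lemma measurable_rieszKernel {d : ℕ} (α : ℝ) : Measurable (rieszKernel α : Rd d → ℝ≥0∞) :=
  (continuous_rieszKernel α).measurable

lemma continuous_rieszKernel_sub {d : ℕ} (α : ℝ) :
    Continuous (fun q : Rd d × Rd d => rieszKernel α (q.1 - q.2)) :=
  (continuous_rieszKernel α).comp (continuous_fst.sub continuous_snd)

lemma measurable_rieszKernel_sub {d : ℕ} (α : ℝ) :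
    Measurable (fun q : Rd d × Rd d => rieszKernel α (q.1 - q.2)) :=
  (continuous_rieszKernel_sub α).measurable

/-- The kernel decreases with the distance, so the supremum over `|x - y| ≥ |z|` is at most `k(z)`,
a locally integrable power. -/
lemma abs_offDiagSup_rieszInteraction_le {d : ℕ} {α : ℝ} (hαd : α < d) (K : Set (Rd d))
    (z : Rd d) :
    ‖offDiagSup (rieszInteraction α) K z‖ ≤ 1 * ‖z‖ ^ (-((d : ℝ) - α)) := by
  unfold offDiagSup
  set S := {w : EReal | ∃ x ∈ K, ∃ y ∈ K, ‖z‖ ≤ ‖x - y‖ ∧ w = rieszInteraction α x y} with hS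
  have hrhs : 0 ≤ 1 * ‖z‖ ^ (-((d : ℝ) - α)) := by positivity
  rcases S.eq_empty_or_nonempty with h | ⟨w, hw⟩
  · rw [h, sSup_empty]
    simpa using hrhs
  have h0 : 0 ≤ sSup S := by
    refine le_trans ?_ (le_sSup hw)
    obtain ⟨x, -, y, -, -, rfl⟩ := hw
    exact EReal.coe_ennreal_nonneg _
  rw [Real.norm_of_nonneg (EReal.toReal_nonneg h0)]
  rcases eq_or_ne z 0 with rfl | hz
  -- At `z = 0` the diagonal is included and the supremum is infinite; `toReal` sends it to `0`.
  · have : sSup S = ⊤ := by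
      rw [eq_top_iff]
      obtain ⟨x, hx, y, hy, hxy⟩ := hw
      refine le_sSup ⟨x, hx, x, hx, by simp, ?_⟩
      simp [rieszInteraction, rieszKernel_zero hαd]
    rw [this]
    simpa using hrhs
  · have : sSup S ≤ ((‖z‖ ^ (-((d : ℝ) - α)) : ℝ) : EReal) := by
      refine sSup_le ?_
      rintro w ⟨x, -, y, -, hxy, rfl⟩
      have hz' : 0 < ‖z‖ := norm_pos_iff.2 hz
      have hne : x - y ≠ 0 := norm_pos_iff.1 (hz'.trans_le hxy)
      rw [rieszInteraction, rieszKernel_eq_ofReal α hne, EReal.coe_ennreal_ofReal,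
        max_eq_left (by positivity)]
      exact EReal.coe_le_coe_iff.2
        (Real.rpow_le_rpow_of_nonpos hz' hxy (by linarith))
    rw [one_mul]
    have := EReal.toReal_le_toReal this (ne_bot_of_le_ne_bot EReal.zero_ne_bot h0)
      (EReal.coe_ne_top _)
    simpa using this

/-- The supremum depends on `z` only through `‖z‖`, and monotone functions of a real variable are
Borel. -/
lemma measurable_offDiagSup {d : ℕ} (W : Rd d → Rd d → EReal) (K : Set (Rd d)) :
    Measurable (offDiagSup W K) := by
  have : Antitone fun r : ℝ =>
      sSup {w : EReal | ∃ x ∈ K, ∃ y ∈ K, r ≤ ‖x - y‖ ∧ w = W x y} := by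
    intro r s hrs
    refine sSup_le_sSup ?_
    rintro w ⟨x, hx, y, hy, hxy, rfl⟩
    exact ⟨x, hx, y, hy, hrs.trans hxy, rfl⟩
  exact measurable_ereal_toReal.comp (this.measurable.comp measurable_norm)

theorem interactionRegular_rieszInteraction {d : ℕ} {α : ℝ} (hα : 0 < α) (hαd : α < d) :
    InteractionRegular (rieszInteraction α : Rd d → Rd d → EReal) where
  ne_bot x y := EReal.coe_ennreal_ne_bot _
  continuous := continuous_coe_ennreal_ereal.comp (continuous_rieszKernel_sub α)
  symm x y := by rw [rieszInteraction, rieszInteraction, rieszKernel_sub_comm]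
  finite_off_diag x y hxy := by
    simpa [rieszInteraction] using rieszKernel_ne_top α (sub_ne_zero.2 hxy)
  locallyIntegrable_sup K _ := by
    have hd : 1 ≤ Module.finrank ℝ (Rd d) := by
      rw [finrank_euclideanSpace_fin]
      have : (0 : ℝ) < d := hα.trans hαd
      exact_mod_cast this
    refine locallyIntegrable_of_norm_le_rpow (C := 1) (α := (d : ℝ) - α) hd ?_
      (ae_of_all _ (abs_offDiagSup_rieszInteraction_le hαd K))
      (measurable_offDiagSup _ K).aestronglyMeasurable
    rw [finrank_euclideanSpace_fin]
    linarith

/-! ### The Riesz kernel as a mixture of Gaussian kernels -/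

lemma lintegral_rpow_mul_exp_neg {s r : ℝ} (hs : 0 < s) (hr : 0 < r) :
    ∫⁻ t in Set.Ioi (0 : ℝ), ENNReal.ofReal (t ^ (s - 1)) * ENNReal.ofReal (Real.exp (-t * r)) =
      ENNReal.ofReal (Real.Gamma s) * ENNReal.ofReal (r ^ (-s)) := by
  have hint := Real.integral_rpow_mul_exp_neg_mul_Ioi hs hr
  have hpos : 0 < (1 / r) ^ s * Real.Gamma s := by
    have := Real.Gamma_pos_of_pos hs
    positivity
  have hI : Integrable (fun t : ℝ => t ^ (s - 1) * Real.exp (-(r * t)))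
      (volume.restrict (Set.Ioi 0)) := by
    -- A non-integrable function has Bochner integral `0`, whereas the Gamma value is positive.
    by_contra h
    rw [integral_undef h] at hint
    linarith
  have hnn : 0 ≤ᵐ[volume.restrict (Set.Ioi 0)] fun t : ℝ => t ^ (s - 1) * Real.exp (-(r * t)) := by
    refine (ae_restrict_iff' measurableSet_Ioi).2 (ae_of_all _ fun t ht => ?_)
    have : (0 : ℝ) < t := ht
    show (0 : ℝ) ≤ t ^ (s - 1) * Real.exp (-(r * t))
    positivity
  have h := ofReal_integral_eq_lintegral_ofReal hI hnn
  rw [hint] at h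
  rw [← ENNReal.ofReal_mul (Real.Gamma_pos_of_pos hs).le]
  rw [show Real.Gamma s * r ^ (-s) = (1 / r) ^ s * Real.Gamma s by
    rw [one_div, Real.inv_rpow hr.le, Real.rpow_neg hr.le, mul_comm], h]
  refine setLIntegral_congr_fun measurableSet_Ioi fun t ht => ?_
  have : (0 : ℝ) < t := ht
  show ENNReal.ofReal (t ^ (s - 1)) * ENNReal.ofReal (Real.exp (-t * r)) =
    ENNReal.ofReal (t ^ (s - 1) * Real.exp (-(r * t)))
  rw [← ENNReal.ofReal_mul (by positivity)]
  congr 3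
  ring

lemma lintegral_Ioi_rpow (s : ℝ) :
    ∫⁻ t in Set.Ioi (0 : ℝ), ENNReal.ofReal (t ^ s) = ∞ := by
  by_contra h
  refine not_integrableOn_Ioi_rpow s ⟨?_, ?_⟩
  · exact (measurable_id.pow_const s).aestronglyMeasurable
  · rw [hasFiniteIntegral_iff_ofReal]
    · exact lt_top_iff_ne_top.2 h
    · refine (ae_restrict_iff' measurableSet_Ioi).2 (ae_of_all _ fun t ht => ?_)
      exact Real.rpow_nonneg (le_of_lt ht) s

/-- The weight of the Gaussian kernel `exp (-t |x|²)` in the Riesz kernel. -/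
def mixWeight (d : ℕ) (α : ℝ) (t : ℝ) : ℝ≥0∞ :=
  ENNReal.ofReal (Real.Gamma (((d : ℝ) - α) / 2))⁻¹ *
    ENNReal.ofReal (t ^ (((d : ℝ) - α) / 2 - 1))

lemma measurable_mixWeight (d : ℕ) (α : ℝ) : Measurable (mixWeight d α) :=
  ((measurable_id.pow_const _).ennreal_ofReal).const_mul _

lemma mixWeight_pos {d : ℕ} {α : ℝ} (hαd : α < d) {t : ℝ} (ht : 0 < t) :
    mixWeight d α t ≠ 0 := by
  have := Real.Gamma_pos_of_pos (s := ((d : ℝ) - α) / 2) (by linarith)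
  refine mul_ne_zero ?_ ?_
  · simpa using this
  · simpa using Real.rpow_pos_of_pos ht _

lemma mixWeight_ne_top (d : ℕ) (α t : ℝ) : mixWeight d α t ≠ ∞ :=
  ENNReal.mul_ne_top ENNReal.ofReal_ne_top ENNReal.ofReal_ne_top

/-- The Gaussian kernel `exp (-t |x|²)`. -/
def gaussKernel {d : ℕ} (t : ℝ) (x : Rd d) : ℝ≥0∞ := ENNReal.ofReal (Real.exp (-t * ‖x‖ ^ 2))

/-- This is the Gamma integral with `s = (d - α)/2` and `r = |x|²`. Both sides are infinite at `x =
0`, so the identity also holds on the diagonal and may be integrated against measures with atoms. -/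
theorem rieszKernel_eq_lintegral {d : ℕ} {α : ℝ} (hαd : α < d) (x : Rd d) :
    rieszKernel α x = ∫⁻ t in Set.Ioi (0 : ℝ), mixWeight d α t * gaussKernel t x := by
  have hs : 0 < ((d : ℝ) - α) / 2 := by linarith
  have hΓ := Real.Gamma_pos_of_pos hs
  simp only [mixWeight, gaussKernel, mul_assoc]
  rw [lintegral_const_mul' _ _ ENNReal.ofReal_ne_top]
  rcases eq_or_ne x 0 with rfl | hx
  · simp only [norm_zero, ne_eq, OfNat.ofNat_ne_zero, not_false_eq_true, zero_pow, mul_zero,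
      Real.exp_zero, ENNReal.ofReal_one, mul_one, lintegral_Ioi_rpow]
    rw [rieszKernel_zero hαd, ENNReal.mul_top]
    simpa using hΓ
  · have hx' : 0 < ‖x‖ := norm_pos_iff.2 hx
    rw [lintegral_rpow_mul_exp_neg hs (by positivity), ← mul_assoc,
      ← ENNReal.ofReal_mul (by positivity), inv_mul_cancel₀ hΓ.ne', ENNReal.ofReal_one, one_mul,
      rieszKernel_eq_ofReal α hx, ← Real.rpow_natCast, ← Real.rpow_mul hx'.le]
    congr 2
    push_cast
    ring

/-! ### Boundedness and continuity of the Riesz potential -/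

lemma nontrivial_Rd {d : ℕ} {α : ℝ} (hα : 0 < α) (hαd : α < d) : Nontrivial (Rd d) := by
  have : (0 : ℝ) < d := hα.trans hαd
  have hd : 0 < d := by exact_mod_cast this
  refine Module.nontrivial_of_finrank_pos (R := ℝ) ?_
  rwa [finrank_euclideanSpace_fin]

/-- Hölder's inequality is applied below with a finite exponent. If `p = ∞`, essential boundedness
by `M` gives `f^(s+1) ≤ M^s f` with `f` integrable; otherwise `p` itself serves. -/
lemma exists_finite_exponent {Ω : Type*} [MeasurableSpace Ω] {m : Measure Ω} {f : Ω → ℝ}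
    {p : ℝ≥0∞} (hf : MemLp f p m) (h1 : ∫⁻ x, ENNReal.ofReal (f x) ∂m ≠ ∞)
    {s : ℝ} (hs : 1 < s) (hp : ENNReal.ofReal s < p) :
    ∃ r : ℝ, s < r ∧ ∫⁻ x, ENNReal.ofReal (f x) ^ r ∂m ≠ ∞ := by
  rcases eq_or_ne p ∞ with rfl | hp'
  · refine ⟨s + 1, by linarith, ?_⟩
    have hM : ∀ᵐ x ∂m, ‖f x‖ₑ ≤ eLpNormEssSup f m := enorm_ae_le_eLpNormEssSup f m
    have hMtop : eLpNormEssSup f m ≠ ∞ := by simpa using hf.2.ne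
    refine ne_top_of_le_ne_top (b := eLpNormEssSup f m ^ s * ∫⁻ x, ENNReal.ofReal (f x) ∂m) ?_ ?_
    · exact ENNReal.mul_ne_top (ENNReal.rpow_ne_top_of_nonneg (by linarith) hMtop) h1
    · rw [← lintegral_const_mul' _ _ (ENNReal.rpow_ne_top_of_nonneg (by linarith) hMtop)]
      refine lintegral_mono_ae ?_
      filter_upwards [hM] with x hx
      rw [ENNReal.rpow_add_of_nonneg _ _ (by linarith) zero_le_one, ENNReal.rpow_one]
      gcongr
      exact (Real.ofReal_le_enorm _).trans hx
  · have hp0 : p ≠ 0 := (zero_le.trans_lt hp).ne'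
    refine ⟨p.toReal, (ENNReal.ofReal_lt_iff_lt_toReal (by linarith) hp').1 hp, ?_⟩
    refine ne_top_of_le_ne_top
      (lintegral_rpow_enorm_lt_top_of_eLpNorm_lt_top hp0 hp' hf.2).ne ?_
    refine lintegral_mono fun x => ?_
    dsimp only
    gcongr
    exact Real.ofReal_le_enorm _

lemma setLIntegral_ball_rieszKernel_rpow_ne_top {d : ℕ} {α : ℝ} (hα : 0 < α) (hαd : α < d)
    {q : ℝ} (hq : ((d : ℝ) - α) * q < d) (δ : ℝ) :
    ∫⁻ x in Metric.ball (0 : Rd d) δ, rieszKernel α x ^ q ≠ ∞ := by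
  have := nontrivial_Rd hα hαd
  have hd : 1 ≤ Module.finrank ℝ (Rd d) := Module.finrank_pos
  have hint : IntegrableOn (fun x : Rd d => ‖x‖ ^ (-(((d : ℝ) - α) * q))) (Metric.ball 0 δ) := by
    refine integrableOn_ball_of_norm_le_rpow (C := 1) (α := ((d : ℝ) - α) * q) hd ?_ ?_ ?_
    · rwa [finrank_euclideanSpace_fin]
    · refine ae_of_all _ fun x => ?_
      rw [one_mul, Real.norm_of_nonneg (by positivity)]
    · exact (measurable_norm.pow_const _).aestronglyMeasurable
  refine ne_top_of_le_ne_top hint.lintegral_lt_top.ne (lintegral_mono_ae ?_)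
  refine ae_restrict_of_ae ?_
  have : ∀ᵐ x : Rd d, x ≠ 0 := by simp [ae_iff]
  filter_upwards [this] with x hx
  have hx' : 0 < ‖x‖ := norm_pos_iff.2 hx
  rw [rieszKernel_eq_ofReal α hx, ENNReal.ofReal_rpow_of_pos (by positivity),
    ← Real.rpow_mul hx'.le, neg_mul]

lemma rieszKernel_le_min_add_indicator {d : ℕ} {α : ℝ} (hαd : α < d) {δ : ℝ} (hδ : 0 < δ)
    (x : Rd d) :
    rieszKernel α x ≤ min (rieszKernel α x) (ENNReal.ofReal (δ ^ (-((d : ℝ) - α)))) +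
      (Metric.ball 0 δ).indicator (rieszKernel α) x := by
  by_cases hx : x ∈ Metric.ball 0 δ
  · rw [Set.indicator_of_mem hx]
    exact le_add_self
  · rw [Set.indicator_of_notMem hx, add_zero, le_min_iff]
    have hx' : δ ≤ ‖x‖ := by simpa using hx
    refine ⟨le_rfl, ?_⟩
    rw [rieszKernel_eq_ofReal α (norm_pos_iff.1 (hδ.trans_le hx'))]
    exact ENNReal.ofReal_le_ofReal (Real.rpow_le_rpow_of_nonpos hδ hx' (by linarith))

lemma continuous_lintegral_min_rieszKernel {d : ℕ} (α : ℝ) (μ : Measure (Rd d))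
    [IsFiniteMeasure μ] {M : ℝ≥0∞} (hM : M ≠ ∞) :
    Continuous fun x => ∫⁻ y, min (rieszKernel α (x - y)) M ∂μ := by
  refine continuous_iff_continuousAt.2 fun x => ?_
  refine tendsto_lintegral_filter_of_dominated_convergence (fun _ => M) ?_ ?_ ?_ ?_
  · exact Eventually.of_forall fun x =>
      ((measurable_rieszKernel α).comp (measurable_const.sub measurable_id)).min measurable_const
  · exact Eventually.of_forall fun x => ae_of_all _ fun y => min_le_right _ _
  · rw [lintegral_const]
    exact ENNReal.mul_ne_top hM (measure_ne_top _ _)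
  · refine ae_of_all _ fun y => Continuous.tendsto ?_ x
    exact ((continuous_rieszKernel α).comp (continuous_id.sub continuous_const)).min
      continuous_const

/-- The kernel is split at distance `δ`. The truncated kernel has a bounded continuous potential,
and the remainder is at most `near δ`, uniformly in `x`, by Hölder and translation invariance. As
`near δ → 0`, `U` is a uniform limit of continuous functions. -/
theorem rieszPotential_bounded_continuous {d : ℕ} {α : ℝ} (hα : 0 < α) (hαd : α < d)
    (μ : Measure (Rd d)) [IsProbabilityMeasure μ] {p : ℝ≥0∞}
    (hp : ENNReal.ofReal ((d : ℝ) / α) < p) {f : Rd d → ℝ} (hf : MemLp f p volume)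
    (hμf : μ = volume.withDensity (fun x => ENNReal.ofReal (f x))) :
    (∃ B : ℝ≥0, ∀ x, rieszPotential α μ x ≤ B) ∧
      Continuous fun x => (rieszPotential α μ x).toReal := by
  have := nontrivial_Rd hα hαd
  have hd0 : (0 : ℝ) < d := hα.trans hαd
  have hFm : AEMeasurable (fun x => ENNReal.ofReal (f x)) volume :=
    hf.1.aemeasurable.ennreal_ofReal
  have h1 : ∫⁻ x, ENNReal.ofReal (f x) ≠ ∞ := by
    have := measure_ne_top μ Set.univ
    rwa [hμf, withDensity_apply _ MeasurableSet.univ, Measure.restrict_univ] at this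
  obtain ⟨r, hr, hFr⟩ := exists_finite_exponent hf h1 ((one_lt_div hα).2 hαd) hp
  have hr1 : 1 < r := ((one_lt_div hα).2 hαd).trans hr
  have hconj : r.conjExponent.HolderConjugate r := (Real.HolderConjugate.conjExponent hr1).symm
  set q := r.conjExponent with hq_def
  have hq0 : 0 < q := hconj.pos
  have hq : ((d : ℝ) - α) * q < d := by
    have h2 : q = r / (r - 1) := rfl
    -- With `q = r/(r - 1)`, the claim `(d - α) r < d (r - 1)` is just `d < α r`.
    rw [h2, mul_div_assoc', div_lt_iff₀ (by linarith)]
    rw [div_lt_iff₀ hα] at hr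
    linarith
  set near : ℝ → ℝ≥0∞ := fun δ => (∫⁻ x in Metric.ball (0 : Rd d) δ, rieszKernel α x ^ q) ^ (1 / q) *
    (∫⁻ x, ENNReal.ofReal (f x) ^ r) ^ (1 / r) with hnear
  have hC : (∫⁻ x, ENNReal.ofReal (f x) ^ r) ^ (1 / r) ≠ ∞ :=
    ENNReal.rpow_ne_top_of_nonneg (by positivity) hFr
  have near_ne_top : ∀ δ, near δ ≠ ∞ := fun δ =>
    ENNReal.mul_ne_top (ENNReal.rpow_ne_top_of_nonneg (by positivity)
      (setLIntegral_ball_rieszKernel_rpow_ne_top hα hαd hq δ)) hC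
  have near_tendsto : Tendsto near (𝓝[>] 0) (𝓝 0) := by
    have hvol : Tendsto (fun δ : ℝ => volume (Metric.ball (0 : Rd d) δ)) (𝓝[>] 0) (𝓝 0) := by
      have : Tendsto (fun δ : ℝ => ENNReal.ofReal (δ ^ Module.finrank ℝ (Rd d)) *
          volume (Metric.ball (0 : Rd d) 1)) (𝓝[>] 0) (𝓝 0) := by
        have h0 : Tendsto (fun δ : ℝ => ENNReal.ofReal (δ ^ Module.finrank ℝ (Rd d)))
            (𝓝[>] 0) (𝓝 0) := by
          have : Continuous (fun δ : ℝ => ENNReal.ofReal (δ ^ Module.finrank ℝ (Rd d))) :=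
            ENNReal.continuous_ofReal.comp (continuous_pow _)
          refine (this.tendsto' 0 0 ?_).mono_left nhdsWithin_le_nhds
          rw [zero_pow (Module.finrank_pos).ne', ENNReal.ofReal_zero]
        simpa using ENNReal.Tendsto.mul_const h0 (Or.inr (measure_ball_lt_top.ne))
      refine this.congr' ?_
      filter_upwards [self_mem_nhdsWithin] with δ hδ
      rw [Measure.addHaar_ball _ _ (le_of_lt hδ)]
    -- The radius is capped at `1` so that every ball lies in a fixed one where `k^q` has finite
    -- integral.
    have h0 := tendsto_setLIntegral_zero (s := fun δ : ℝ => Metric.ball (0 : Rd d) (min δ 1))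
      (setLIntegral_ball_rieszKernel_rpow_ne_top hα hαd hq 1) (l := 𝓝[>] 0) ?_
    · have h2 := (h0.ennrpow_const (1 / q))
      rw [ENNReal.zero_rpow_of_pos (by positivity)] at h2
      have h3 := ENNReal.Tendsto.mul_const (b := (∫⁻ x, ENNReal.ofReal (f x) ^ r) ^ (1 / r)) h2
        (Or.inr hC)
      rw [zero_mul] at h3
      refine h3.congr' ?_
      filter_upwards [Ioo_mem_nhdsGT (zero_lt_one' ℝ)] with δ hδ
      rw [hnear, min_eq_left hδ.2.le, Measure.restrict_restrict measurableSet_ball,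
        Set.inter_eq_left.2 (Metric.ball_subset_ball hδ.2.le)]
    · refine tendsto_of_tendsto_of_tendsto_of_le_of_le tendsto_const_nhds hvol
        (fun _ => zero_le) fun δ => ?_
      exact (Measure.restrict_apply_le _ _).trans
        (measure_mono (Metric.ball_subset_ball (min_le_left _ _)))
  have hnear_le : ∀ δ x, ∫⁻ y, (Metric.ball 0 δ).indicator (rieszKernel α) (x - y) ∂μ ≤ near δ := by
    intro δ x
    have hkm : Measurable ((Metric.ball (0 : Rd d) δ).indicator (rieszKernel α)) :=
      (measurable_rieszKernel α).indicator measurableSet_ball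
    have hkm' : Measurable fun y => (Metric.ball 0 δ).indicator (rieszKernel α) (x - y) :=
      hkm.comp (measurable_const.sub measurable_id)
    rw [hμf, lintegral_withDensity_eq_lintegral_mul₀ hFm hkm'.aemeasurable, mul_comm]
    refine (ENNReal.lintegral_mul_le_Lp_mul_Lq volume hconj hkm'.aemeasurable hFm).trans ?_
    rw [hnear]
    dsimp only
    rw [lintegral_sub_left_eq_self
      (fun z => (Metric.ball (0 : Rd d) δ).indicator (rieszKernel α) z ^ q) x,
      ← lintegral_indicator measurableSet_ball]
    refine le_of_eq ?_
    congr 3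
    ext z
    by_cases hz : z ∈ Metric.ball (0 : Rd d) δ
    · simp only [Set.indicator_of_mem hz]
    · simp only [Set.indicator_of_notMem hz, ENNReal.zero_rpow_of_pos hq0]
  have hdecomp : ∀ δ > 0, ∀ x, rieszPotential α μ x ≤
      ∫⁻ y, min (rieszKernel α (x - y)) (ENNReal.ofReal (δ ^ (-((d : ℝ) - α)))) ∂μ + near δ := by
    intro δ hδ x
    refine le_trans ?_ (add_le_add_right (hnear_le δ x) _)
    rw [← lintegral_add_left]
    · exact lintegral_mono fun y => rieszKernel_le_min_add_indicator hαd hδ (x - y)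
    · exact ((measurable_rieszKernel α).comp (measurable_const.sub measurable_id)).min
        measurable_const
  have hmin_le : ∀ (M : ℝ≥0∞) (x : Rd d), ∫⁻ y, min (rieszKernel α (x - y)) M ∂μ ≤ M := by
    intro M x
    refine (lintegral_mono fun y => min_le_right _ _).trans ?_
    simp
  have hbound : ∃ B : ℝ≥0, ∀ x, rieszPotential α μ x ≤ B := by
    refine ⟨(ENNReal.ofReal (1 ^ (-((d : ℝ) - α))) + near 1).toNNReal, fun x => ?_⟩
    rw [ENNReal.coe_toNNReal (ENNReal.add_ne_top.2 ⟨ENNReal.ofReal_ne_top, near_ne_top 1⟩)]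
    exact (hdecomp 1 one_pos x).trans (add_le_add_left (hmin_le _ x) _)
  refine ⟨hbound, ?_⟩
  obtain ⟨B, hB⟩ := hbound
  refine continuous_of_uniform_approx_of_continuous fun u hu => ?_
  obtain ⟨ε, hε, hεu⟩ := Metric.mem_uniformity_dist.1 hu
  obtain ⟨δ, hδε, hδ⟩ := ((near_tendsto.eventually_lt_const
    (ENNReal.ofReal_pos.2 hε)).and self_mem_nhdsWithin).exists
  have hδ : 0 < δ := hδ
  set M := ENNReal.ofReal (δ ^ (-((d : ℝ) - α)))
  have hMtop : ∀ x, ∫⁻ y, min (rieszKernel α (x - y)) M ∂μ ≠ ∞ := fun x =>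
    ne_top_of_le_ne_top ENNReal.ofReal_ne_top (hmin_le M x)
  refine ⟨fun x => (∫⁻ y, min (rieszKernel α (x - y)) M ∂μ).toReal, ?_, fun x => hεu ?_⟩
  · exact ENNReal.continuousOn_toReal.comp_continuous
      (continuous_lintegral_min_rieszKernel α μ ENNReal.ofReal_ne_top) hMtop
  · have hU : rieszPotential α μ x ≠ ∞ := ne_top_of_le_ne_top ENNReal.coe_ne_top (hB x)
    have hle : (∫⁻ y, min (rieszKernel α (x - y)) M ∂μ).toReal ≤ (rieszPotential α μ x).toReal :=
      ENNReal.toReal_mono hU (lintegral_mono fun y => min_le_left _ _)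
    have hle' := ENNReal.toReal_mono (ENNReal.add_ne_top.2 ⟨hMtop x, near_ne_top δ⟩) (hdecomp δ hδ x)
    rw [ENNReal.toReal_add (hMtop x) (near_ne_top δ)] at hle'
    have hn : (near δ).toReal < ε := by
      rwa [← ENNReal.lt_ofReal_iff_toReal_lt (near_ne_top δ)]
    rw [Real.dist_eq, abs_of_nonneg (by linarith)]
    linarith

/-! ### Positive definiteness of the Gaussian kernel -/

/-- The mutual energy of two measures for the Gaussian kernel `exp (-t |x|²)`. -/
def gaussEnergy {d : ℕ} (t : ℝ) (μ ν : Measure (Rd d)) : ℝ :=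
  ∫ q, Real.exp (-t * ‖q.1 - q.2‖ ^ 2) ∂(μ.prod ν)

lemma continuous_charFun {d : ℕ} (μ : Measure (Rd d)) [IsFiniteMeasure μ] :
    Continuous (charFun μ) := by
  have : charFun μ = fun t => ∫ x, Complex.exp (inner ℝ x t * Complex.I) ∂μ := by
    ext t
    exact charFun_apply t
  rw [this]
  refine continuous_of_dominated (bound := fun _ => 1) (fun t => ?_) (fun t => ?_)
    (integrable_const 1) ?_
  · refine Continuous.aestronglyMeasurable ?_
    fun_prop
  · refine ae_of_all _ fun x => ?_
    rw [Complex.norm_exp_ofReal_mul_I]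
  · refine ae_of_all _ fun x => ?_
    fun_prop

lemma integrable_gaussian {d : ℕ} {b : ℝ} (hb : 0 < b) :
    Integrable (fun v : Rd d => Real.exp (-b * ‖v‖ ^ 2)) := by
  have h := (GaussianFourier.integrable_cexp_neg_mul_sq_norm_add (V := Rd d) (b := (b : ℂ))
    (by simpa using hb) 0 0).norm
  refine h.congr (ae_of_all _ fun v => ?_)
  simp only [zero_mul, add_zero, Complex.norm_exp]
  congr 1
  norm_cast

lemma integrable_exp_neg_mul_norm_sub_sq {d : ℕ} {t : ℝ} (ht : 0 < t) (μ ν : Measure (Rd d))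
    [IsFiniteMeasure μ] [IsFiniteMeasure ν] :
    Integrable (fun q : Rd d × Rd d => Real.exp (-t * ‖q.1 - q.2‖ ^ 2)) (μ.prod ν) := by
  refine Integrable.mono' (integrable_const 1) (Continuous.aestronglyMeasurable (by fun_prop))
    (ae_of_all _ fun q => ?_)
  rw [Real.norm_of_nonneg (Real.exp_pos _).le]
  refine Real.exp_le_one_iff.2 ?_
  have : 0 ≤ ‖q.1 - q.2‖ ^ 2 := by positivity
  nlinarith

lemma ofReal_gaussEnergy {d : ℕ} {t : ℝ} (ht : 0 < t) (μ ν : Measure (Rd d))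
    [IsFiniteMeasure μ] [IsFiniteMeasure ν] :
    ENNReal.ofReal (gaussEnergy t μ ν) = ∫⁻ q, gaussKernel t (q.1 - q.2) ∂(μ.prod ν) :=
  ofReal_integral_eq_lintegral_ofReal (integrable_exp_neg_mul_norm_sub_sq ht μ ν)
    (ae_of_all _ fun _ => (Real.exp_pos _).le)

lemma gaussEnergy_nonneg {d : ℕ} (t : ℝ) (μ ν : Measure (Rd d)) : 0 ≤ gaussEnergy t μ ν :=
  integral_nonneg fun _ => (Real.exp_pos _).le

open scoped ComplexConjugate in
lemma integrable_gaussian_mul_charFun {d : ℕ} {b : ℝ} (hb : 0 < b) (μ ν : Measure (Rd d))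
    [IsProbabilityMeasure μ] [IsProbabilityMeasure ν] :
    Integrable (fun v : Rd d =>
      (Real.exp (-b * ‖v‖ ^ 2) : ℂ) * (charFun μ v * conj (charFun ν v))) := by
  have h1 := continuous_charFun μ
  have h2 := continuous_charFun ν
  refine Integrable.mono' (integrable_gaussian (d := d) hb)
    (Continuous.aestronglyMeasurable ?_) (ae_of_all _ fun v => ?_)
  · have h3 : Continuous fun v => conj (charFun ν v) := Complex.continuous_conj.comp h2
    fun_prop
  · rw [norm_mul, norm_mul, RCLike.norm_conj, Complex.norm_real,
      Real.norm_of_nonneg (Real.exp_pos _).le]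
    have h3 := norm_charFun_le_one (μ := μ) v
    have h4 := norm_charFun_le_one (μ := ν) v
    have h5 : ‖charFun μ v‖ * ‖charFun ν v‖ ≤ 1 := mul_le_one₀ h3 (norm_nonneg _) h4
    exact mul_le_of_le_one_right (Real.exp_pos _).le h5

open scoped ComplexConjugate in
-- A Gaussian is the Fourier transform of a Gaussian, here of parameter `1/(4t)`. Integrating `F q
-- v` first in `v` gives the kernel, and first in `q` gives the product of characteristic functions;
-- Fubini equates the two.
theorem gaussEnergy_fourier {d : ℕ} {t : ℝ} (ht : 0 < t) (μ ν : Measure (Rd d))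
    [IsProbabilityMeasure μ] [IsProbabilityMeasure ν] :
    (4 * Real.pi * t) ^ ((d : ℝ) / 2) * gaussEnergy t μ ν =
      ∫ v : Rd d, Real.exp (-(1 / (4 * t)) * ‖v‖ ^ 2) *
        (charFun μ v * conj (charFun ν v)).re := by
  set b : ℝ := 1 / (4 * t) with hb_def
  have hb : 0 < b := by positivity
  set F : (Rd d × Rd d) → Rd d → ℂ := fun q v =>
    Complex.exp (-(b : ℂ) * (‖v‖ : ℂ) ^ 2 + Complex.I * (inner ℝ (q.1 - q.2) v : ℝ)) with hF
  have hFint : Integrable (Function.uncurry F) ((μ.prod ν).prod volume) := by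
    refine Integrable.mono' (g := fun z : (Rd d × Rd d) × Rd d => Real.exp (-b * ‖z.2‖ ^ 2))
      ((integrable_gaussian (d := d) hb).comp_snd _) (Continuous.aestronglyMeasurable ?_)
      (ae_of_all _ fun z => ?_)
    · simp only [hF, Function.uncurry_def]
      fun_prop
    · simp only [hF, Function.uncurry_def, Complex.norm_exp]
      refine le_of_eq ?_
      congr 1
      rw [mul_comm Complex.I, Complex.add_re, Complex.re_ofReal_mul, Complex.I_re, mul_zero,
        add_zero]
      norm_cast
  have hswap := integral_integral_swap hFint
  have hleft : ∀ q, ∫ v, F q v =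
      (((4 * Real.pi * t) ^ ((d : ℝ) / 2) * Real.exp (-t * ‖q.1 - q.2‖ ^ 2) : ℝ) : ℂ) := by
    intro q
    simp only [hF]
    rw [GaussianFourier.integral_cexp_neg_mul_sq_norm_add (by simpa using hb),
      finrank_euclideanSpace_fin]
    have h1 : (Real.pi : ℂ) / (b : ℂ) = ((4 * Real.pi * t : ℝ) : ℂ) := by
      rw [hb_def]
      push_cast
      field_simp
    rw [h1, Complex.ofReal_mul ((4 * Real.pi * t) ^ ((d : ℝ) / 2)),
      Complex.ofReal_cpow (by positivity)]
    congr 1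
    · norm_num
    · rw [Complex.ofReal_exp, Complex.I_sq, hb_def]
      congr 1
      push_cast
      field_simp
  have hright : ∀ v, ∫ q, F q v ∂(μ.prod ν) =
      (Real.exp (-b * ‖v‖ ^ 2) : ℂ) * (charFun μ v * conj (charFun ν v)) := by
    intro v
    rw [← charFun_neg, charFun_apply, charFun_apply, ← integral_prod_mul, ← integral_const_mul]
    refine integral_congr_ae (ae_of_all _ fun q => ?_)
    simp only [hF]
    rw [Complex.ofReal_exp, ← Complex.exp_add, ← Complex.exp_add, inner_sub_left, inner_neg_right]
    congr 1
    push_cast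
    ring
  simp only [hleft, hright] at hswap
  rw [integral_complex_ofReal, integral_const_mul] at hswap
  have hre := congrArg Complex.re hswap
  rw [Complex.ofReal_re] at hre
  rw [gaussEnergy, hre]
  have := (integral_re (integrable_gaussian_mul_charFun hb μ ν))
  simp only [RCLike.re_to_complex] at this
  rw [← this]
  simp only [Complex.re_ofReal_mul]

/-- On the Fourier side, convolution multiplies the characteristic function by one of modulus at
most `1`. -/
lemma gaussEnergy_conv_le {d : ℕ} {t : ℝ} (ht : 0 < t) (μ ρ : Measure (Rd d))
    [IsProbabilityMeasure μ] [IsProbabilityMeasure ρ] :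
    gaussEnergy t (μ ∗ ρ) (μ ∗ ρ) ≤ gaussEnergy t μ μ := by
  have hb : 0 < 1 / (4 * t) := by positivity
  have hC : 0 < (4 * Real.pi * t) ^ ((d : ℝ) / 2) := by positivity
  refine le_of_mul_le_mul_left ?_ hC
  rw [gaussEnergy_fourier ht, gaussEnergy_fourier ht]
  have key : ∀ η : Measure (Rd d), ∀ [IsProbabilityMeasure η], Integrable fun v : Rd d =>
      Real.exp (-(1 / (4 * t)) * ‖v‖ ^ 2) * (charFun η v * (starRingEnd ℂ) (charFun η v)).re := by
    intro η _
    have := (integrable_gaussian_mul_charFun hb η η).re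
    simpa only [RCLike.re_to_complex, Complex.re_ofReal_mul] using this
  refine integral_mono (key _) (key _) fun v => ?_
  refine mul_le_mul_of_nonneg_left ?_ (Real.exp_pos _).le
  rw [Complex.mul_conj, Complex.mul_conj, Complex.ofReal_re, Complex.ofReal_re, charFun_conv,
    map_mul]
  refine mul_le_of_le_one_right (Complex.normSq_nonneg _) ?_
  rw [Complex.normSq_eq_norm_sq]
  exact pow_le_one₀ (norm_nonneg _) (norm_charFun_le_one v)

lemma gaussEnergy_sub {d : ℕ} {t : ℝ} (ht : 0 < t) (μ ν : Measure (Rd d))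
    [IsProbabilityMeasure μ] [IsProbabilityMeasure ν] :
    (4 * Real.pi * t) ^ ((d : ℝ) / 2) *
        (gaussEnergy t μ μ + gaussEnergy t ν ν - 2 * gaussEnergy t μ ν) =
      ∫ v : Rd d, Real.exp (-(1 / (4 * t)) * ‖v‖ ^ 2) *
        Complex.normSq (charFun μ v - charFun ν v) := by
  have hb : 0 < 1 / (4 * t) := by positivity
  have key : ∀ η η' : Measure (Rd d), ∀ [IsProbabilityMeasure η] [IsProbabilityMeasure η'],
      Integrable fun v : Rd d =>
      Real.exp (-(1 / (4 * t)) * ‖v‖ ^ 2) * (charFun η v * (starRingEnd ℂ) (charFun η' v)).re := by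
    intro η η' _ _
    have := (integrable_gaussian_mul_charFun hb η η').re
    simpa only [RCLike.re_to_complex, Complex.re_ofReal_mul] using this
  rw [mul_sub, mul_add, mul_left_comm, gaussEnergy_fourier ht, gaussEnergy_fourier ht,
    gaussEnergy_fourier ht, ← integral_add (key _ _) (key _ _), ← integral_const_mul]
  refine (integral_sub ((key μ μ).add (key ν ν)) ((key μ ν).const_mul 2)).symm.trans ?_
  refine integral_congr_ae (ae_of_all _ fun v => ?_)
  simp only [Pi.add_apply, Complex.normSq_sub, Complex.mul_conj, Complex.ofReal_re]
  ring

lemma two_mul_gaussEnergy_le {d : ℕ} {t : ℝ} (ht : 0 < t) (μ ν : Measure (Rd d))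
    [IsProbabilityMeasure μ] [IsProbabilityMeasure ν] :
    2 * gaussEnergy t μ ν ≤ gaussEnergy t μ μ + gaussEnergy t ν ν := by
  have h := gaussEnergy_sub ht μ ν
  have hC : 0 < (4 * Real.pi * t) ^ ((d : ℝ) / 2) := by positivity
  have h0 : 0 ≤ ∫ v : Rd d, Real.exp (-(1 / (4 * t)) * ‖v‖ ^ 2) *
      Complex.normSq (charFun μ v - charFun ν v) :=
    integral_nonneg fun v => mul_nonneg (Real.exp_pos _).le (Complex.normSq_nonneg _)
  rw [← h] at h0
  have := nonneg_of_mul_nonneg_right h0 hC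
  linarith

/-- The integrand in `gaussEnergy_sub` is continuous and nonnegative; if its integral is zero it
vanishes everywhere, and the characteristic functions agree. -/
lemma eq_of_two_mul_gaussEnergy_eq {d : ℕ} {t : ℝ} (ht : 0 < t) (μ ν : Measure (Rd d))
    [IsProbabilityMeasure μ] [IsProbabilityMeasure ν]
    (h : 2 * gaussEnergy t μ ν = gaussEnergy t μ μ + gaussEnergy t ν ν) : μ = ν := by
  have hsub := gaussEnergy_sub ht μ ν
  rw [← h, sub_self, mul_zero] at hsub
  have hcont : Continuous fun v : Rd d => Real.exp (-(1 / (4 * t)) * ‖v‖ ^ 2) *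
      Complex.normSq (charFun μ v - charFun ν v) := by
    have h1 := continuous_charFun μ
    have h2 := continuous_charFun ν
    have h3 := Complex.continuous_normSq.comp (h1.sub h2)
    exact Continuous.mul (by fun_prop) h3
  have hint : Integrable fun v : Rd d => Real.exp (-(1 / (4 * t)) * ‖v‖ ^ 2) *
      Complex.normSq (charFun μ v - charFun ν v) := by
    have hb : 0 < 1 / (4 * t) := by positivity
    refine Integrable.mono' ((integrable_gaussian (d := d) hb).mul_const 4)
      hcont.aestronglyMeasurable (ae_of_all _ fun v => ?_)
    rw [Real.norm_of_nonneg (mul_nonneg (Real.exp_pos _).le (Complex.normSq_nonneg _)),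
      Complex.normSq_eq_norm_sq]
    have h1 := norm_sub_le (charFun μ v) (charFun ν v)
    have h3 := norm_charFun_le_one (μ := μ) v
    have h4 := norm_charFun_le_one (μ := ν) v
    have h5 := norm_nonneg (charFun μ v - charFun ν v)
    gcongr
    nlinarith
  have h0 := (integral_eq_zero_iff_of_nonneg
    (fun v => mul_nonneg (Real.exp_pos _).le (Complex.normSq_nonneg _)) hint).1 hsub.symm
  have h1 := (hcont.ae_eq_iff_eq volume continuous_zero).1 h0
  refine Measure.ext_of_charFun ?_
  ext v
  have h2 := congrFun h1 v
  simp only [Pi.zero_apply, mul_eq_zero, Real.exp_ne_zero, false_or, map_eq_zero, sub_eq_zero]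
    at h2
  exact h2

/-! ### Mutual Riesz energies -/

/-- The mutual Riesz energy of two measures. -/
def pairEnergy {d : ℕ} (α : ℝ) (μ ν : Measure (Rd d)) : ℝ≥0∞ :=
  ∫⁻ x, ∫⁻ y, rieszKernel α (x - y) ∂ν ∂μ

lemma pairEnergy_eq_lintegral_prod {d : ℕ} (α : ℝ) (μ ν : Measure (Rd d)) [SFinite ν] :
    pairEnergy α μ ν = ∫⁻ q, rieszKernel α (q.1 - q.2) ∂(μ.prod ν) :=
  (lintegral_prod _ (measurable_rieszKernel_sub α).aemeasurable).symm

lemma pairEnergy_eq_lintegral_rieszPotential {d : ℕ} (α : ℝ) (μ ν : Measure (Rd d)) :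
    pairEnergy α μ ν = ∫⁻ x, rieszPotential α ν x ∂μ := rfl

lemma measurable_gaussKernel_uncurry {d : ℕ} :
    Measurable fun z : ℝ × (Rd d × Rd d) => gaussKernel z.1 (z.2.1 - z.2.2) := by
  unfold gaussKernel
  refine ENNReal.measurable_ofReal.comp (Continuous.measurable ?_)
  fun_prop

lemma measurable_lintegral_gaussKernel {d : ℕ} (m : Measure (Rd d × Rd d)) [SFinite m] :
    Measurable fun t : ℝ => ∫⁻ q, gaussKernel t (q.1 - q.2) ∂m :=
  measurable_gaussKernel_uncurry.lintegral_prod_right'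

theorem pairEnergy_eq_mixture {d : ℕ} {α : ℝ} (hαd : α < d) (μ ν : Measure (Rd d))
    [IsFiniteMeasure μ] [IsFiniteMeasure ν] :
    pairEnergy α μ ν =
      ∫⁻ t in Set.Ioi (0 : ℝ), mixWeight d α t * ENNReal.ofReal (gaussEnergy t μ ν) := by
  rw [pairEnergy_eq_lintegral_prod]
  simp only [rieszKernel_eq_lintegral hαd]
  rw [lintegral_lintegral_swap]
  · refine setLIntegral_congr_fun measurableSet_Ioi fun t ht => ?_
    rw [ofReal_gaussEnergy ht, lintegral_const_mul' _ _ (mixWeight_ne_top d α t)]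
  · refine Measurable.aemeasurable ?_
    exact ((measurable_mixWeight d α).comp measurable_snd).mul
      (measurable_gaussKernel_uncurry.comp measurable_swap)

lemma aemeasurable_mixWeight_mul_gaussEnergy {d : ℕ} (α : ℝ) (μ ν : Measure (Rd d))
    [IsFiniteMeasure μ] [IsFiniteMeasure ν] :
    AEMeasurable (fun t => mixWeight d α t * ENNReal.ofReal (gaussEnergy t μ ν))
      (volume.restrict (Set.Ioi (0 : ℝ))) := by
  refine ((measurable_mixWeight d α).mul
    (measurable_lintegral_gaussKernel (μ.prod ν))).aemeasurable.congr ?_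
  refine (ae_restrict_iff' measurableSet_Ioi).2 (ae_of_all _ fun t ht => ?_)
  simp only [Pi.mul_apply, ofReal_gaussEnergy ht μ ν]

theorem pairEnergy_conv_le {d : ℕ} {α : ℝ} (hαd : α < d) (μ ρ : Measure (Rd d))
    [IsProbabilityMeasure μ] [IsProbabilityMeasure ρ] :
    pairEnergy α (μ ∗ ρ) (μ ∗ ρ) ≤ pairEnergy α μ μ := by
  rw [pairEnergy_eq_mixture hαd, pairEnergy_eq_mixture hαd]
  refine setLIntegral_mono' measurableSet_Ioi fun t ht => ?_
  gcongr
  exact gaussEnergy_conv_le ht μ ρ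

lemma two_mul_mixWeight_mul_le {d : ℕ} (α : ℝ) {t : ℝ} (ht : 0 < t) (μ ν : Measure (Rd d))
    [IsProbabilityMeasure μ] [IsProbabilityMeasure ν] :
    2 * (mixWeight d α t * ENNReal.ofReal (gaussEnergy t μ ν)) ≤
      mixWeight d α t * ENNReal.ofReal (gaussEnergy t μ μ) +
        mixWeight d α t * ENNReal.ofReal (gaussEnergy t ν ν) := by
  rw [← mul_add, mul_left_comm, ← ENNReal.ofReal_add (gaussEnergy_nonneg _ _ _)
    (gaussEnergy_nonneg _ _ _), show (2 : ℝ≥0∞) = ENNReal.ofReal 2 by simp,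
    ← ENNReal.ofReal_mul (by norm_num)]
  gcongr
  exact two_mul_gaussEnergy_le ht μ ν

lemma two_mul_pairEnergy_eq {d : ℕ} {α : ℝ} (hαd : α < d) (μ ν : Measure (Rd d))
    [IsProbabilityMeasure μ] [IsProbabilityMeasure ν] :
    2 * pairEnergy α μ ν =
      ∫⁻ t in Set.Ioi (0 : ℝ), 2 * (mixWeight d α t * ENNReal.ofReal (gaussEnergy t μ ν)) := by
  rw [pairEnergy_eq_mixture hαd, lintegral_const_mul' _ _ (by simp)]

lemma pairEnergy_add_eq {d : ℕ} {α : ℝ} (hαd : α < d) (μ ν : Measure (Rd d))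
    [IsProbabilityMeasure μ] [IsProbabilityMeasure ν] :
    pairEnergy α μ μ + pairEnergy α ν ν =
      ∫⁻ t in Set.Ioi (0 : ℝ), (mixWeight d α t * ENNReal.ofReal (gaussEnergy t μ μ) +
        mixWeight d α t * ENNReal.ofReal (gaussEnergy t ν ν)) := by
  rw [pairEnergy_eq_mixture hαd μ μ, pairEnergy_eq_mixture hαd ν ν,
    lintegral_add_left' (aemeasurable_mixWeight_mul_gaussEnergy α μ μ)]

theorem two_mul_pairEnergy_le {d : ℕ} {α : ℝ} (hαd : α < d) (μ ν : Measure (Rd d))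
    [IsProbabilityMeasure μ] [IsProbabilityMeasure ν] :
    2 * pairEnergy α μ ν ≤ pairEnergy α μ μ + pairEnergy α ν ν := by
  rw [two_mul_pairEnergy_eq hαd, pairEnergy_add_eq hαd]
  exact setLIntegral_mono' measurableSet_Ioi fun t ht => two_mul_mixWeight_mul_le α ht μ ν

/-- The Gaussian inequality holds for each `t`. As the smaller integral is finite, the reversed
inequality of integrals forces equality for almost every `t`; a single `t > 0` then identifies the
measures. -/
theorem eq_of_pairEnergy_add_le {d : ℕ} {α : ℝ} (hαd : α < d) (μ ν : Measure (Rd d))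
    [IsProbabilityMeasure μ] [IsProbabilityMeasure ν] (hfin : pairEnergy α μ ν ≠ ∞)
    (h : pairEnergy α μ μ + pairEnergy α ν ν ≤ 2 * pairEnergy α μ ν) : μ = ν := by
  have hfin' : 2 * pairEnergy α μ ν ≠ ∞ := ENNReal.mul_ne_top (by simp) hfin
  rw [two_mul_pairEnergy_eq hαd] at h hfin'
  rw [pairEnergy_add_eq hαd] at h
  have hae := ae_eq_of_ae_le_of_lintegral_le
    ((ae_restrict_iff' measurableSet_Ioi).2 (ae_of_all volume fun t ht =>
      two_mul_mixWeight_mul_le α ht μ ν)) hfin'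
    ((aemeasurable_mixWeight_mul_gaussEnergy α μ μ).add
      (aemeasurable_mixWeight_mul_gaussEnergy α ν ν)) h
  have hne : (ae (volume.restrict (Set.Ioi (0 : ℝ)))).NeBot := by
    rw [ae_neBot, Ne, Measure.restrict_eq_zero]
    simp
  obtain ⟨t, ht, ht0⟩ := (hae.and (ae_restrict_mem measurableSet_Ioi)).exists
  have ht0 : 0 < t := ht0
  refine eq_of_two_mul_gaussEnergy_eq ht0 μ ν ?_
  dsimp only at ht
  rw [← mul_add, mul_left_comm, ENNReal.mul_right_inj (mixWeight_pos hαd ht0)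
    (mixWeight_ne_top d α t), ← ENNReal.ofReal_add (gaussEnergy_nonneg _ _ _)
    (gaussEnergy_nonneg _ _ _), show (2 : ℝ≥0∞) = ENNReal.ofReal 2 by simp,
    ← ENNReal.ofReal_mul (by norm_num), ENNReal.ofReal_eq_ofReal_iff] at ht
  · exact ht
  · exact mul_nonneg zero_le_two (gaussEnergy_nonneg _ _ _)
  · exact add_nonneg (gaussEnergy_nonneg _ _ _) (gaussEnergy_nonneg _ _ _)

/-! ### Extended-real integrals of functions bounded below -/

/-- Positive and negative parts of `a - c`, related additively so that the identity survives `a = ∞`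
and can be integrated in `ℝ≥0∞`. -/
lemma toENNReal_coe_sub_coe_add (a : ℝ≥0∞) (c : ℝ≥0) :
    ((a : EReal) - ((c : ℝ≥0∞) : EReal)).toENNReal + c =
      a + (-((a : EReal) - ((c : ℝ≥0∞) : EReal))).toENNReal := by
  induction a with
  | top => simp
  | coe a =>
    have h : (((a : ℝ≥0∞) : EReal) - ((c : ℝ≥0∞) : EReal)) = (((a : ℝ) - (c : ℝ) : ℝ) : EReal) := by
      rw [EReal.coe_sub]
      rfl
    rw [h, ← EReal.coe_neg, EReal.toENNReal_of_ne_top (EReal.coe_ne_top _),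
      EReal.toENNReal_of_ne_top (EReal.coe_ne_top _), EReal.toReal_coe, EReal.toReal_coe,
      ← ENNReal.ofReal_coe_nnreal, ← ENNReal.ofReal_coe_nnreal (p := a)]
    rcases le_total (a : ℝ) c with hac | hac
    · rw [ENNReal.ofReal_of_nonpos (by linarith), zero_add,
        ← ENNReal.ofReal_add (by positivity) (by linarith)]
      congr 1
      ring
    · rw [ENNReal.ofReal_of_nonpos (p := -((a : ℝ) - c)) (by linarith), add_zero,
        ← ENNReal.ofReal_add (by linarith) (by positivity)]
      congr 1
      ring

lemma toENNReal_neg_coe_sub_coe_le (a : ℝ≥0∞) (c : ℝ≥0) :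
    (-((a : EReal) - ((c : ℝ≥0∞) : EReal))).toENNReal ≤ c := by
  induction a with
  | top => simp
  | coe a =>
    have h : (((a : ℝ≥0∞) : EReal) - ((c : ℝ≥0∞) : EReal)) = (((a : ℝ) - (c : ℝ) : ℝ) : EReal) := by
      rw [EReal.coe_sub]
      rfl
    rw [h, ← EReal.coe_neg, EReal.toENNReal_of_ne_top (EReal.coe_ne_top _), EReal.toReal_coe,
      ← ENNReal.ofReal_coe_nnreal]
    refine ENNReal.ofReal_le_ofReal ?_
    have : (0 : ℝ) ≤ a := a.2
    linarith

lemma coe_sub_coe_eq_of_add_eq {p n g : ℝ≥0∞} {c : ℝ≥0} (hn : n ≠ ∞) (h : p + c = g + n) :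
    (p : EReal) - (n : EReal) = (g : EReal) - ((c : ℝ≥0∞) : EReal) := by
  lift n to ℝ≥0 using hn
  induction g with
  | top =>
    have hp : p = ∞ := by
      rw [top_add] at h
      rcases ENNReal.add_eq_top.1 h with h | h
      · exact h
      · exact absurd h ENNReal.coe_ne_top
    subst hp
    exact (EReal.top_sub_coe (n : ℝ)).trans (EReal.top_sub_coe (c : ℝ)).symm
  | coe g =>
    have hp : p ≠ ∞ := by
      rintro rfl
      rw [top_add] at h
      exact absurd h.symm (ENNReal.add_ne_top.2 ⟨ENNReal.coe_ne_top, ENNReal.coe_ne_top⟩)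
    lift p to ℝ≥0 using hp
    have h' : p + c = g + n := by exact_mod_cast h
    have h'' : (p : ℝ) + c = g + n := by exact_mod_cast h'
    have h3 : (p : ℝ) - n = g - c := by linarith
    have h4 : (((p : ℝ) - n : ℝ) : EReal) = (((g : ℝ) - c : ℝ) : EReal) := by rw [h3]
    rw [EReal.coe_sub, EReal.coe_sub] at h4
    exact h4

theorem extIntegral_coe_sub_const {Ω : Type*} [MeasurableSpace Ω] (m : Measure Ω)
    [IsProbabilityMeasure m] {f : Ω → EReal} {g : Ω → ℝ≥0∞} (hg : Measurable g) (c : ℝ≥0)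
    (hf : ∀ x, f x = (g x : EReal) - ((c : ℝ≥0∞) : EReal)) :
    extIntegral m f = ((∫⁻ x, g x ∂m : ℝ≥0∞) : EReal) - ((c : ℝ≥0∞) : EReal) := by
  have hn : ∫⁻ x, (-f x).toENNReal ∂m ≤ c := by
    calc ∫⁻ x, (-f x).toENNReal ∂m ≤ ∫⁻ _, (c : ℝ≥0∞) ∂m := lintegral_mono fun x => by
          rw [hf]
          exact toENNReal_neg_coe_sub_coe_le _ _
      _ = c := by simp
  refine coe_sub_coe_eq_of_add_eq (ne_top_of_le_ne_top ENNReal.coe_ne_top hn) ?_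
  have hc : (c : ℝ≥0∞) = ∫⁻ _, (c : ℝ≥0∞) ∂m := by simp
  rw [hc, ← lintegral_add_right _ measurable_const, ← lintegral_add_left hg]
  refine lintegral_congr fun x => ?_
  rw [hf]
  exact toENNReal_coe_sub_coe_add _ _

lemma half_mul_coe (a : ℝ≥0∞) : ((1 / 2 : ℝ) : EReal) * (a : EReal) = ((a / 2 : ℝ≥0∞) : EReal) := by
  rw [ENNReal.div_eq_inv_mul, EReal.coe_ennreal_mul]
  congr 1
  rw [show (2⁻¹ : ℝ≥0∞) = ENNReal.ofReal (1 / 2) by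
    rw [one_div, ENNReal.ofReal_inv_of_pos two_pos]; simp, EReal.coe_ennreal_ofReal,
    max_eq_left (by norm_num)]

lemma half_mul_coe_sub (a : ℝ≥0∞) (c : ℝ≥0) :
    ((1 / 2 : ℝ) : EReal) * ((a : EReal) - ((c : ℝ≥0∞) : EReal)) =
      ((a / 2 : ℝ≥0∞) : EReal) - (((c / 2 : ℝ≥0) : ℝ≥0∞) : EReal) := by
  induction a with
  | top =>
    rw [ENNReal.top_div_of_ne_top (by simp)]
    have h1 : ((∞ : ℝ≥0∞) : EReal) - ((c : ℝ≥0∞) : EReal) = ⊤ := EReal.top_sub_coe (c : ℝ)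
    have h2 : ((∞ : ℝ≥0∞) : EReal) - (((c / 2 : ℝ≥0) : ℝ≥0∞) : EReal) = ⊤ :=
      EReal.top_sub_coe ((c / 2 : ℝ≥0) : ℝ)
    rw [h1, h2, EReal.coe_mul_top_of_pos (by norm_num)]
  | coe a =>
    have : ((a : ℝ≥0∞) / 2) = ((a / 2 : ℝ≥0) : ℝ≥0∞) := by
      rw [ENNReal.coe_div two_ne_zero]; rfl
    rw [this]
    have h : (((1 / 2 : ℝ) * ((a : ℝ) - c) : ℝ) : EReal) =
        ((((a / 2 : ℝ≥0) : ℝ) - ((c / 2 : ℝ≥0) : ℝ) : ℝ) : EReal) := by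
      congr 1
      push_cast
      ring
    rw [EReal.coe_mul, EReal.coe_sub, EReal.coe_sub] at h
    exact h

/-! ### The energy functional, shifted to be nonnegative -/

/-- The functional `ν ↦ ∫ (V + B) dν + (1/2) ∬ k(x - y) dν(x) dν(y)`. -/
def shiftedEnergy {d : ℕ} (α : ℝ) (V : Rd d → ℝ) (B : ℝ≥0) (ν : Measure (Rd d)) : ℝ≥0∞ :=
  ∫⁻ x, ENNReal.ofReal (V x + B) ∂ν + pairEnergy α ν ν / 2

lemma coe_eq_ofReal_add_sub {v : ℝ} {B : ℝ≥0} (h : 0 ≤ v + B) :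
    (v : EReal) = ((ENNReal.ofReal (v + B) : ℝ≥0∞) : EReal) - ((B : ℝ≥0∞) : EReal) := by
  rw [EReal.coe_ennreal_ofReal, max_eq_left h]
  have : (v : EReal) = ((v + B - B : ℝ) : EReal) := by
    congr 1
    ring
  rw [this, EReal.coe_sub]
  rfl

lemma coe_add_coe_sub (a b : ℝ≥0∞) (c : ℝ≥0) :
    ((a : EReal) - ((c : ℝ≥0∞) : EReal)) + (b : EReal) =
      ((a + b : ℝ≥0∞) : EReal) - ((c : ℝ≥0∞) : EReal) := by
  rw [EReal.coe_ennreal_add, sub_eq_add_neg, sub_eq_add_neg, add_right_comm]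

theorem rieszEnergy_eq_shiftedEnergy {d : ℕ} (α : ℝ) {V : Rd d → ℝ} (hVm : Measurable V)
    {B : ℝ≥0} (hVB : ∀ x, 0 ≤ V x + B) (ν : ProbabilityMeasure (Rd d)) :
    rieszEnergy α V ν =
      ((shiftedEnergy α V B (ν : Measure (Rd d)) : ℝ≥0∞) : EReal) - ((B : ℝ≥0∞) : EReal) := by
  rw [rieszEnergy, shiftedEnergy, extIntegral_coe_sub_const _
    (hVm.add_const (B : ℝ)).ennreal_ofReal B fun x => coe_eq_ofReal_add_sub (hVB x),
    half_mul_coe, coe_add_coe_sub]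
  rfl

theorem energy_eq_shiftedEnergy {d : ℕ} (α : ℝ) {V : Rd d → ℝ} (hVm : Measurable V)
    {B : ℝ≥0} (hVB : ∀ x, 0 ≤ V x + B) (ν : ProbabilityMeasure (Rd d)) :
    energy V (rieszInteraction α) ν =
      ((shiftedEnergy α V B (ν : Measure (Rd d)) : ℝ≥0∞) : EReal) - ((B : ℝ≥0∞) : EReal) := by
  set v : Rd d → ℝ≥0∞ := fun x => ENNReal.ofReal (V x + B) with hv
  have hvm : Measurable v := (hVm.add_const (B : ℝ)).ennreal_ofReal
  have hg : Measurable fun q : Rd d × Rd d => v q.1 + v q.2 + rieszKernel α (q.1 - q.2) :=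
    ((hvm.comp measurable_fst).add (hvm.comp measurable_snd)).add (measurable_rieszKernel_sub α)
  -- Each of the two copies of `V` is shifted by `B`; the factor `1/2` of the energy turns `2 * B`
  -- back into `B`.
  have h2B : ∀ q : Rd d × Rd d, (V q.1 : EReal) + (V q.2 : EReal) + rieszInteraction α q.1 q.2 =
      ((v q.1 + v q.2 + rieszKernel α (q.1 - q.2) : ℝ≥0∞) : EReal) -
        (((2 * B : ℝ≥0) : ℝ≥0∞) : EReal) := by
    intro q
    rw [rieszInteraction, ← coe_add_coe_sub]
    congr 1
    rw [← EReal.coe_add, coe_eq_ofReal_add_sub (v := V q.1 + V q.2) (B := 2 * B), hv,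
      ← ENNReal.ofReal_add (hVB _) (hVB _)]
    · congr 3
      push_cast
      ring
    · have h1 := hVB q.1
      have h2 := hVB q.2
      push_cast
      linarith
  rw [energy, extIntegral_coe_sub_const _ hg (2 * B) h2B, half_mul_coe_sub, shiftedEnergy,
    pairEnergy_eq_lintegral_prod, lintegral_add_right _ (measurable_rieszKernel_sub α),
    lintegral_add_left (f := fun q : Rd d × Rd d => v q.1) (hvm.comp measurable_fst)]
  have h1 : ∫⁻ q, v q.1 ∂((ν : Measure (Rd d)).prod (ν : Measure (Rd d))) =
      ∫⁻ x, v x ∂(ν : Measure (Rd d)) := by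
    rw [lintegral_prod (fun q : Rd d × Rd d => v q.1) (hvm.comp measurable_fst).aemeasurable]
    simp
  have h2 : ∫⁻ q, v q.2 ∂((ν : Measure (Rd d)).prod (ν : Measure (Rd d))) =
      ∫⁻ x, v x ∂(ν : Measure (Rd d)) := by
    rw [lintegral_prod (fun q : Rd d × Rd d => v q.2) (hvm.comp measurable_snd).aemeasurable]
    simp
  rw [h1, h2, ENNReal.add_div, ENNReal.add_div, ENNReal.add_halves]
  congr 3
  rw [mul_div_cancel_left₀ _ two_ne_zero]

lemma coe_sub_coe_le_iff {a b : ℝ≥0∞} {c : ℝ≥0} :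
    (a : EReal) - ((c : ℝ≥0∞) : EReal) ≤ (b : EReal) - ((c : ℝ≥0∞) : EReal) ↔ a ≤ b := by
  refine ⟨fun h => ?_, fun h => EReal.sub_le_sub (by exact_mod_cast h) le_rfl⟩
  have h2 : ∀ a : ℝ≥0∞, (a : EReal) - ((c : ℝ≥0∞) : EReal) + ((c : ℝ≥0∞) : EReal) = a :=
    fun a => EReal.sub_add_cancel (b := (c : ℝ))
  have h3 := add_le_add_left h ((c : ℝ≥0∞) : EReal)
  rw [h2, h2] at h3
  exact_mod_cast h3

/-! ### The equilibrium measure -/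

section Prescribing

variable {d : ℕ} {α R : ℝ} {μ : Measure (Rd d)} {B : ℝ≥0}

lemma prescribingPotential_add_nonneg (hB : ∀ x, rieszPotential α μ x ≤ B) (x : Rd d) :
    0 ≤ prescribingPotential α R μ x + B := by
  have h1 := ENNReal.toReal_mono ENNReal.coe_ne_top (hB x)
  have h2 := le_max_right (‖x‖ ^ 2 - R ^ 2) 0
  rw [ENNReal.coe_toReal] at h1
  rw [prescribingPotential]
  linarith

lemma norm_sq_le_prescribingPotential (hB : ∀ x, rieszPotential α μ x ≤ B) (x : Rd d) :
    ‖x‖ ^ 2 ≤ prescribingPotential α R μ x + (R ^ 2 + B) := by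
  have h1 := ENNReal.toReal_mono ENNReal.coe_ne_top (hB x)
  have h2 := le_max_left (‖x‖ ^ 2 - R ^ 2) 0
  rw [ENNReal.coe_toReal] at h1
  rw [prescribingPotential]
  linarith

lemma prescribingPotential_le_norm_sq (x : Rd d) :
    prescribingPotential α R μ x ≤ ‖x‖ ^ 2 := by
  have h1 : 0 ≤ (rieszPotential α μ x).toReal := ENNReal.toReal_nonneg
  have h2 : max (‖x‖ ^ 2 - R ^ 2) 0 ≤ ‖x‖ ^ 2 := max_le (by nlinarith) (by positivity)
  rw [prescribingPotential]
  linarith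

lemma continuous_prescribingPotential
    (hUc : Continuous fun x => (rieszPotential α μ x).toReal) :
    Continuous (prescribingPotential α R μ) := by
  unfold prescribingPotential
  fun_prop

theorem confining_prescribingPotential (hB : ∀ x, rieszPotential α μ x ≤ B)
    (hUc : Continuous fun x => (rieszPotential α μ x).toReal) :
    Confining (prescribingPotential α R μ) where
  continuous := continuous_prescribingPotential hUc
  tendsto_atTop := by
    have h1 : Tendsto (fun x : Rd d => ‖x‖ ^ 2 - (R ^ 2 + B)) (cocompact (Rd d)) atTop :=
      tendsto_atTop_add_const_right _ _
        ((tendsto_pow_atTop two_ne_zero).comp (tendsto_norm_cocompact_atTop (E := Rd d)))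
    refine tendsto_atTop_mono (fun x => ?_) h1
    linarith [norm_sq_le_prescribingPotential (R := R) hB x]
  integrable_exp_neg := by
    refine Integrable.mono' ((integrable_gaussian (d := d) one_pos).const_mul
      (Real.exp (R ^ 2 + B))) ?_ (ae_of_all _ fun x => ?_)
    · exact (Real.continuous_exp.comp
        (continuous_prescribingPotential hUc).neg).aestronglyMeasurable
    · rw [Real.norm_of_nonneg (Real.exp_pos _).le, ← Real.exp_add]
      refine Real.exp_le_exp.2 ?_
      linarith [norm_sq_le_prescribingPotential (R := R) hB x]

theorem dominates_prescribingPotential (hB : ∀ x, rieszPotential α μ x ≤ B) :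
    Dominates (prescribingPotential α R μ) (rieszInteraction α) := by
  -- As `V + B ≥ 0`, these constants make the lower bound nonpositive, while `W ≥ 0`.
  refine ⟨-B, 1 / 2, by norm_num, by norm_num, fun x y => ?_⟩
  refine le_trans ?_ (EReal.coe_ennreal_nonneg _)
  rw [← EReal.coe_zero, EReal.coe_le_coe_iff]
  linarith [prescribingPotential_add_nonneg (R := R) hB x,
    prescribingPotential_add_nonneg (R := R) hB y]

/-- The Euler-Lagrange condition built into `V`: the effective potential `V + U` is the penalty
`[|x|² - R²]_+`. The constant `B` makes every term nonnegative. -/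
lemma ofReal_prescribingPotential_add (hB : ∀ x, rieszPotential α μ x ≤ B) (x : Rd d) :
    ENNReal.ofReal (prescribingPotential α R μ x + B) + rieszPotential α μ x =
      ENNReal.ofReal (max (‖x‖ ^ 2 - R ^ 2) 0) + B := by
  have hfin : rieszPotential α μ x ≠ ∞ := ne_top_of_le_ne_top ENNReal.coe_ne_top (hB x)
  rw [← ENNReal.ofReal_toReal hfin, ← ENNReal.ofReal_add (prescribingPotential_add_nonneg hB x)
    ENNReal.toReal_nonneg, ← ENNReal.ofReal_coe_nnreal (p := B),
    ← ENNReal.ofReal_add (le_max_right _ _) (by positivity), prescribingPotential]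
  congr 1
  ring

lemma measurable_rieszPotential (α : ℝ) (μ : Measure (Rd d)) [SFinite μ] :
    Measurable (rieszPotential α μ) :=
  (measurable_rieszKernel_sub α).lintegral_prod_right'

lemma lintegral_prescribingPotential_add [SFinite μ] (hB : ∀ x, rieszPotential α μ x ≤ B)
    (ν : Measure (Rd d)) [IsProbabilityMeasure ν] :
    ∫⁻ x, ENNReal.ofReal (prescribingPotential α R μ x + B) ∂ν + pairEnergy α ν μ =
      ∫⁻ x, ENNReal.ofReal (max (‖x‖ ^ 2 - R ^ 2) 0) ∂ν + B := by
  rw [pairEnergy_eq_lintegral_rieszPotential,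
    ← lintegral_add_right _ (measurable_rieszPotential α μ),
    lintegral_congr (ofReal_prescribingPotential_add hB),
    lintegral_add_right _ measurable_const]
  simp

lemma pairEnergy_le_of_rieszPotential_le (hB : ∀ x, rieszPotential α μ x ≤ B)
    (ν : Measure (Rd d)) [IsProbabilityMeasure ν] : pairEnergy α ν μ ≤ B := by
  rw [pairEnergy_eq_lintegral_rieszPotential]
  refine (lintegral_mono hB).trans ?_
  simp

/-- The penalty vanishes on the support of `μ`, so integrating the Euler-Lagrange identity against
`μ` leaves only `B`. -/
lemma shiftedEnergy_add_half [IsProbabilityMeasure μ] (hB : ∀ x, rieszPotential α μ x ≤ B)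
    (hsupp : μ.support ⊆ Metric.closedBall 0 R) :
    shiftedEnergy α (prescribingPotential α R μ) B μ + pairEnergy α μ μ / 2 = B := by
  have hc : ∫⁻ x, ENNReal.ofReal (max (‖x‖ ^ 2 - R ^ 2) 0) ∂μ = 0 := by
    have hcont : Continuous fun x : Rd d => max (‖x‖ ^ 2 - R ^ 2) 0 := by fun_prop
    rw [lintegral_eq_zero_iff hcont.measurable.ennreal_ofReal]
    filter_upwards [Measure.support_mem_ae (μ := μ)] with x hx
    have hx' : ‖x‖ ≤ R := by simpa using hsupp hx
    have : ‖x‖ ^ 2 ≤ R ^ 2 := by gcongr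
    rw [max_eq_right (by linarith), ENNReal.ofReal_zero]
    rfl
  have h := lintegral_prescribingPotential_add (R := R) hB μ
  rw [hc, zero_add] at h
  rw [shiftedEnergy, add_assoc, ENNReal.add_halves, h]

theorem shiftedEnergy_add_pairEnergy_ge [IsProbabilityMeasure μ]
    (hB : ∀ x, rieszPotential α μ x ≤ B) (ν : Measure (Rd d)) [IsProbabilityMeasure ν] :
    B + pairEnergy α ν ν / 2 ≤
      shiftedEnergy α (prescribingPotential α R μ) B ν + pairEnergy α ν μ := by
  rw [shiftedEnergy, add_right_comm, lintegral_prescribingPotential_add hB ν]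
  gcongr
  exact le_add_self

lemma shiftedEnergy_ne_top [IsProbabilityMeasure μ] (hB : ∀ x, rieszPotential α μ x ≤ B)
    (hsupp : μ.support ⊆ Metric.closedBall 0 R) :
    shiftedEnergy α (prescribingPotential α R μ) B μ ≠ ∞ := by
  refine ne_top_of_le_ne_top (ENNReal.coe_ne_top (r := B)) ?_
  rw [← shiftedEnergy_add_half hB hsupp]
  exact le_self_add

/-- Dropping the penalty of `ν`, the excess energy is at least half of `E(ν,ν) + E(μ,μ) - 2 E(ν,μ)`,
which is nonnegative. The finite quantity `E(μ,μ)/2 + E(ν,μ)` is added to both sides to avoid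
subtraction. -/
theorem shiftedEnergy_min [IsProbabilityMeasure μ] (hαd : α < d)
    (hB : ∀ x, rieszPotential α μ x ≤ B)
    (hsupp : μ.support ⊆ Metric.closedBall 0 R) (ν : Measure (Rd d)) [IsProbabilityMeasure ν] :
    shiftedEnergy α (prescribingPotential α R μ) B μ ≤
      shiftedEnergy α (prescribingPotential α R μ) B ν := by
  have hνμ : pairEnergy α ν μ ≠ ∞ :=
    ne_top_of_le_ne_top ENNReal.coe_ne_top (pairEnergy_le_of_rieszPotential_le hB ν)
  have hμμ : pairEnergy α μ μ / 2 ≠ ∞ :=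
    ENNReal.div_ne_top (ne_top_of_le_ne_top ENNReal.coe_ne_top
      (pairEnergy_le_of_rieszPotential_le hB μ)) (by simp)
  have h2 : pairEnergy α ν μ ≤ pairEnergy α ν ν / 2 + pairEnergy α μ μ / 2 := by
    rw [← ENNReal.add_div, ENNReal.le_div_iff_mul_le (by simp) (by simp), mul_comm]
    exact two_mul_pairEnergy_le hαd ν μ
  have h3 : shiftedEnergy α (prescribingPotential α R μ) B μ +
      (pairEnergy α μ μ / 2 + pairEnergy α ν μ) ≤
      shiftedEnergy α (prescribingPotential α R μ) B ν +
        (pairEnergy α μ μ / 2 + pairEnergy α ν μ) := by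
    calc shiftedEnergy α (prescribingPotential α R μ) B μ +
        (pairEnergy α μ μ / 2 + pairEnergy α ν μ) = B + pairEnergy α ν μ := by
          rw [← add_assoc, shiftedEnergy_add_half hB hsupp]
      _ ≤ B + (pairEnergy α ν ν / 2 + pairEnergy α μ μ / 2) := by gcongr
      _ = (B + pairEnergy α ν ν / 2) + pairEnergy α μ μ / 2 := by rw [add_assoc]
      _ ≤ (shiftedEnergy α (prescribingPotential α R μ) B ν + pairEnergy α ν μ) +
          pairEnergy α μ μ / 2 := by
        exact add_le_add_left (shiftedEnergy_add_pairEnergy_ge hB ν) _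
      _ = _ := by ring
  exact (ENNReal.add_le_add_iff_right (ENNReal.add_ne_top.2 ⟨hμμ, hνμ⟩)).1 h3

theorem eq_of_shiftedEnergy_le [IsProbabilityMeasure μ] (hαd : α < d)
    (hB : ∀ x, rieszPotential α μ x ≤ B)
    (hsupp : μ.support ⊆ Metric.closedBall 0 R) (ν : Measure (Rd d)) [IsProbabilityMeasure ν]
    (h : shiftedEnergy α (prescribingPotential α R μ) B ν ≤
      shiftedEnergy α (prescribingPotential α R μ) B μ) : ν = μ := by
  have hνμ : pairEnergy α ν μ ≠ ∞ :=
    ne_top_of_le_ne_top ENNReal.coe_ne_top (pairEnergy_le_of_rieszPotential_le hB ν)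
  have h3 : (B : ℝ≥0∞) + (pairEnergy α ν ν / 2 + pairEnergy α μ μ / 2) ≤
      B + pairEnergy α ν μ := by
    calc (B : ℝ≥0∞) + (pairEnergy α ν ν / 2 + pairEnergy α μ μ / 2)
        = (B + pairEnergy α ν ν / 2) + pairEnergy α μ μ / 2 := by rw [add_assoc]
      _ ≤ (shiftedEnergy α (prescribingPotential α R μ) B ν + pairEnergy α ν μ) +
          pairEnergy α μ μ / 2 := by
        exact add_le_add_left (shiftedEnergy_add_pairEnergy_ge hB ν) _
      _ ≤ (shiftedEnergy α (prescribingPotential α R μ) B μ + pairEnergy α ν μ) +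
          pairEnergy α μ μ / 2 := by gcongr
      _ = (shiftedEnergy α (prescribingPotential α R μ) B μ + pairEnergy α μ μ / 2) +
          pairEnergy α ν μ := by ring
      _ = B + pairEnergy α ν μ := by rw [shiftedEnergy_add_half hB hsupp]
  have h4 := (ENNReal.add_le_add_iff_left ENNReal.coe_ne_top).1 h3
  rw [← ENNReal.add_div, ENNReal.div_le_iff_le_mul (by simp) (by simp), mul_comm] at h4
  exact eq_of_pairEnergy_add_le hαd ν μ hνμ h4

end Prescribing

/-! ### Lower semicontinuity of the energy -/

lemma tendsto_lintegral_min {X ι : Type*} [TopologicalSpace X] [MeasurableSpace X]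
    [OpensMeasurableSpace X] {l : Filter ι} {νs : ι → ProbabilityMeasure X}
    {ν : ProbabilityMeasure X} (h : Tendsto νs l (𝓝 ν)) {f : X → ℝ≥0∞} (hf : Continuous f)
    (M : ℝ≥0) :
    Tendsto (fun i => ∫⁻ x, min (f x) M ∂(νs i : Measure X)) l
      (𝓝 (∫⁻ x, min (f x) M ∂(ν : Measure X))) := by
  have hne : ∀ x, min (f x) M ≠ ∞ := fun x =>
    ne_top_of_le_ne_top ENNReal.coe_ne_top (min_le_right _ _)
  have hle : ∀ x, (min (f x) M).toNNReal ≤ M := fun x => by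
    rw [← ENNReal.coe_le_coe, ENNReal.coe_toNNReal (hne x)]
    exact min_le_right _ _
  have hc : Continuous fun x => (min (f x) M).toNNReal :=
    ENNReal.continuousOn_toNNReal.comp_continuous (hf.min continuous_const) hne
  let F : BoundedContinuousFunction X ℝ≥0 :=
    BoundedContinuousFunction.mkOfBound ⟨_, hc⟩ M fun x y => by
      have h1 : (((min (f x) M).toNNReal : ℝ≥0) : ℝ) ≤ M := hle x
      have h2 : (((min (f y) M).toNNReal : ℝ≥0) : ℝ) ≤ M := hle y
      have h3 : (0 : ℝ) ≤ ((min (f x) M).toNNReal : ℝ≥0) := NNReal.coe_nonneg _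
      have h4 : (0 : ℝ) ≤ ((min (f y) M).toNNReal : ℝ≥0) := NNReal.coe_nonneg _
      rw [NNReal.dist_eq]
      exact abs_sub_le_iff.2 ⟨by simp only [ContinuousMap.coe_mk]; linarith,
        by simp only [ContinuousMap.coe_mk]; linarith⟩
  have hF : ∀ x, (F x : ℝ≥0∞) = min (f x) M := fun x => ENNReal.coe_toNNReal (hne x)
  simpa only [hF] using (ProbabilityMeasure.tendsto_iff_forall_lintegral_tendsto.1 h) F

/-- The energy functional with confinement and interaction truncated at height `M`. -/
def truncatedEnergy {d : ℕ} (α : ℝ) (V : Rd d → ℝ) (B M : ℝ≥0) (ν : Measure (Rd d)) : ℝ≥0∞ :=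
  ∫⁻ x, min (ENNReal.ofReal (V x + B)) M ∂ν +
    (∫⁻ q, min (rieszKernel α (q.1 - q.2)) M ∂(ν.prod ν)) / 2

lemma truncatedEnergy_le {d : ℕ} (α : ℝ) (V : Rd d → ℝ) (B M : ℝ≥0) (ν : Measure (Rd d))
    [SFinite ν] : truncatedEnergy α V B M ν ≤ shiftedEnergy α V B ν := by
  rw [truncatedEnergy, shiftedEnergy, pairEnergy_eq_lintegral_prod]
  gcongr
  · exact min_le_left _ _
  · exact min_le_left _ _

lemma tendsto_truncatedEnergy {d : ℕ} (α : ℝ) {V : Rd d → ℝ} (hV : Continuous V) (B M : ℝ≥0)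
    {ι : Type*} {l : Filter ι} {νs : ι → ProbabilityMeasure (Rd d)}
    {ν : ProbabilityMeasure (Rd d)} (h : Tendsto νs l (𝓝 ν)) :
    Tendsto (fun i => truncatedEnergy α V B M (νs i : Measure (Rd d))) l
      (𝓝 (truncatedEnergy α V B M (ν : Measure (Rd d)))) := by
  have h1 := tendsto_lintegral_min h
    (ENNReal.continuous_ofReal.comp (hV.add (continuous_const (y := (B : ℝ))))) M
  have hprod : Tendsto (fun i => (νs i).prod (νs i)) l (𝓝 (ν.prod ν)) :=
    (ProbabilityMeasure.continuous_prod.tendsto (ν, ν)).comp (h.prodMk_nhds h)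
  have h2 := tendsto_lintegral_min hprod (continuous_rieszKernel_sub α) M
  exact h1.add (ENNReal.Tendsto.div_const h2 (Or.inr (by simp)))

lemma tendsto_lintegral_min_natCast {X : Type*} [MeasurableSpace X] (m : Measure X)
    {f : X → ℝ≥0∞} (hf : Measurable f) :
    Tendsto (fun n : ℕ => ∫⁻ x, min (f x) ((n : ℝ≥0) : ℝ≥0∞) ∂m) atTop (𝓝 (∫⁻ x, f x ∂m)) := by
  refine lintegral_tendsto_of_tendsto_of_monotone (fun n => (hf.min measurable_const).aemeasurable)
    (ae_of_all _ fun x n k hnk => ?_) (ae_of_all _ fun x => ?_)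
  · dsimp only
    gcongr
  · have h : Tendsto (fun n : ℕ => (((n : ℝ≥0) : ℝ≥0∞))) atTop (𝓝 ∞) := by
      simpa using ENNReal.tendsto_nat_nhds_top
    simpa using (tendsto_const_nhds (x := f x)).min h

/-- Each truncated energy is weakly continuous and bounded by the full one; as they increase to it,
the energy is weakly lower semicontinuous. -/
lemma tendsto_truncatedEnergy_natCast {d : ℕ} (α : ℝ) {V : Rd d → ℝ} (hV : Continuous V)
    (B : ℝ≥0) (ν : Measure (Rd d)) [SFinite ν] :
    Tendsto (fun n : ℕ => truncatedEnergy α V B n ν) atTop (𝓝 (shiftedEnergy α V B ν)) := by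
  have h1 := tendsto_lintegral_min_natCast ν (hV.measurable.add_const (B : ℝ)).ennreal_ofReal
  have h2 := tendsto_lintegral_min_natCast (ν.prod ν) (measurable_rieszKernel_sub α)
  rw [shiftedEnergy, pairEnergy_eq_lintegral_prod]
  exact h1.add (ENNReal.Tendsto.div_const h2 (Or.inr (by simp)))

/-! ### Regularization by convolution with the uniform measure on a small ball -/

/-- The uniform probability measure on the unit ball. -/
def unitBallMeasure (d : ℕ) : Measure (Rd d) :=
  ProbabilityTheory.cond volume (Metric.ball 0 1)

lemma volume_unitBall_ne_zero (d : ℕ) : volume (Metric.ball (0 : Rd d) 1) ≠ 0 :=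
  (Metric.measure_ball_pos volume 0 one_pos).ne'

instance (d : ℕ) : IsProbabilityMeasure (unitBallMeasure d) :=
  ProbabilityTheory.cond_isProbabilityMeasure_of_finite (volume_unitBall_ne_zero d)
    measure_ball_lt_top.ne

lemma ae_unitBallMeasure_norm_le (d : ℕ) : ∀ᵐ y ∂(unitBallMeasure d), ‖y‖ ≤ 1 := by
  filter_upwards [ProbabilityTheory.ae_cond_mem (μ := volume)
    (measurableSet_ball (x := (0 : Rd d)) (ε := 1))] with y hy
  exact (mem_ball_zero_iff.1 hy).le

lemma unitBallMeasure_le (d : ℕ) :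
    unitBallMeasure d ≤ (volume (Metric.ball (0 : Rd d) 1))⁻¹ • volume := by
  rw [unitBallMeasure, ProbabilityTheory.cond]
  exact smul_le_smul_left _ Measure.restrict_le_self

/-- The convolution of `ν` with the uniform measure on the ball of radius `s`. -/
def mollify {d : ℕ} (s : ℝ) (ν : Measure (Rd d)) : Measure (Rd d) :=
  ν ∗ (unitBallMeasure d).map (s • ·)

instance {d : ℕ} (s : ℝ) : IsProbabilityMeasure ((unitBallMeasure d).map (s • ·)) :=
  Measure.isProbabilityMeasure_map (measurable_const_smul s).aemeasurable

instance {d : ℕ} (s : ℝ) (ν : Measure (Rd d)) [IsProbabilityMeasure ν] :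
    IsProbabilityMeasure (mollify s ν) := by
  unfold mollify
  infer_instance

lemma lintegral_mollify {d : ℕ} (s : ℝ) (ν : Measure (Rd d)) [IsProbabilityMeasure ν]
    {g : Rd d → ℝ≥0∞} (hg : Measurable g) :
    ∫⁻ x, g x ∂(mollify s ν) = ∫⁻ q, g (q.1 + s • q.2) ∂(ν.prod (unitBallMeasure d)) := by
  rw [mollify, Measure.lintegral_conv hg, lintegral_prod]
  · refine lintegral_congr fun x => ?_
    exact lintegral_map (hg.comp (measurable_const_add x)) (measurable_const_smul s)
  · exact (hg.comp (Continuous.measurable (by fun_prop))).aemeasurable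

/-- A bounded density is more than (H4) asks for; it is what lets product probabilities be compared
with Lebesgue volume in the lower bound on `Z_N`. -/
lemma mollify_le {d : ℕ} {s : ℝ} (hs : s ≠ 0) (ν : Measure (Rd d)) [IsProbabilityMeasure ν] :
    ∃ M : ℝ≥0, mollify s ν ≤ M • (volume : Measure (Rd d)) := by
  set c : ℝ≥0∞ := (volume (Metric.ball (0 : Rd d) 1))⁻¹ *
    ENNReal.ofReal |(s ^ Module.finrank ℝ (Rd d))⁻¹| with hc
  have hctop : c ≠ ∞ :=
    ENNReal.mul_ne_top (ENNReal.inv_ne_top.2 (volume_unitBall_ne_zero d)) ENNReal.ofReal_ne_top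
  have hmap : (unitBallMeasure d).map (s • ·) ≤ c • (volume : Measure (Rd d)) := by
    refine Measure.le_iff.2 fun A hA => ?_
    rw [Measure.map_apply (measurable_const_smul s) hA]
    refine (unitBallMeasure_le d _).trans ?_
    rw [Measure.smul_apply, Measure.smul_apply, Measure.addHaar_preimage_smul _ hs, smul_eq_mul,
      smul_eq_mul, hc, mul_assoc]
  refine ⟨c.toNNReal, Measure.le_iff.2 fun A hA => ?_⟩
  rw [← lintegral_indicator_one hA, mollify,
    Measure.lintegral_conv (measurable_one.indicator hA)]
  calc ∫⁻ x, ∫⁻ y, A.indicator 1 (x + y) ∂((unitBallMeasure d).map (s • ·)) ∂ν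
      ≤ ∫⁻ x, ∫⁻ y, A.indicator 1 (x + y) ∂(c • (volume : Measure (Rd d))) ∂ν :=
        lintegral_mono fun x => lintegral_mono' hmap le_rfl
    _ = ∫⁻ x, c * volume A ∂ν := by
        refine lintegral_congr fun x => ?_
        rw [lintegral_smul_measure, lintegral_add_left_eq_self (A.indicator 1) x,
          lintegral_indicator_one hA, smul_eq_mul]
    _ = (c.toNNReal • (volume : Measure (Rd d))) A := by
        rw [lintegral_const, measure_univ, mul_one, Measure.smul_apply, ENNReal.smul_def,
          smul_eq_mul, ENNReal.coe_toNNReal hctop]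

lemma tendsto_lintegral_mollify {d : ℕ} (ν : Measure (Rd d)) [IsProbabilityMeasure ν]
    {s : ℕ → ℝ} (hs : Tendsto s atTop (𝓝 0)) (hs1 : ∀ n, |s n| ≤ 1)
    {g : Rd d → ℝ≥0∞} (hg : Continuous g) {G : Rd d → ℝ≥0∞} (hG : Measurable G)
    (hGfin : ∫⁻ x, G x ∂ν ≠ ∞) (hgG : ∀ x y, ‖y‖ ≤ 1 → g (x + y) ≤ G x) :
    Tendsto (fun n => ∫⁻ x, g x ∂(mollify (s n) ν)) atTop (𝓝 (∫⁻ x, g x ∂ν)) := by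
  simp only [fun n => lintegral_mollify (s n) ν hg.measurable]
  have hlim : ∫⁻ x, g x ∂ν = ∫⁻ q, g q.1 ∂(ν.prod (unitBallMeasure d)) := by
    rw [lintegral_prod (fun q : Rd d × Rd d => g q.1)
      (hg.measurable.comp measurable_fst).aemeasurable]
    simp
  rw [hlim]
  refine tendsto_lintegral_of_dominated_convergence (fun q => G q.1) (fun n => ?_) (fun n => ?_)
    ?_ (ae_of_all _ fun q => ?_)
  · exact hg.measurable.comp (Continuous.measurable (by fun_prop))
  · have h1 : ∀ᵐ q ∂(ν.prod (unitBallMeasure d)), ‖q.2‖ ≤ 1 :=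
      Measure.quasiMeasurePreserving_snd.ae (ae_unitBallMeasure_norm_le d)
    filter_upwards [h1] with q hq
    refine hgG _ _ ?_
    rw [norm_smul]
    exact mul_le_one₀ (hs1 n) (norm_nonneg _) hq
  · rw [lintegral_prod (fun q : Rd d × Rd d => G q.1) (hG.comp measurable_fst).aemeasurable]
    simpa using hGfin
  · have h1 : Tendsto (fun n => q.1 + s n • q.2) atTop (𝓝 q.1) := by
      have : Tendsto (fun n => q.1 + s n • q.2) atTop (𝓝 (q.1 + (0 : ℝ) • q.2)) :=
        tendsto_const_nhds.add (hs.smul_const q.2)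
      simpa using this
    exact (hg.tendsto _).comp h1

/-- The liminf bound is lower semicontinuity, through the truncated energies. The limsup bound
combines convergence of the potential term with the fact that mollification does not raise the
interaction energy. -/
theorem exists_bounded_density_approximation {d : ℕ} {α : ℝ} (hαd : α < d) {V : Rd d → ℝ}
    (hV : Continuous V) {B : ℝ≥0} {C : ℝ}
    (hVle : ∀ x, V x ≤ ‖x‖ ^ 2) (hVge : ∀ x, ‖x‖ ^ 2 ≤ V x + C)
    (ν : ProbabilityMeasure (Rd d))
    (hν : shiftedEnergy α V B (ν : Measure (Rd d)) ≠ ∞) :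
    ∃ νs : ℕ → ProbabilityMeasure (Rd d),
      (∀ n, ∃ M : ℝ≥0, (νs n : Measure (Rd d)) ≤ M • volume) ∧
      Tendsto νs atTop (𝓝 ν) ∧
      Tendsto (fun n => shiftedEnergy α V B (νs n : Measure (Rd d))) atTop
        (𝓝 (shiftedEnergy α V B (ν : Measure (Rd d)))) := by
  set s : ℕ → ℝ := fun n => 1 / ((n : ℝ) + 1) with hs_def
  have hs : Tendsto s atTop (𝓝 0) := tendsto_one_div_add_atTop_nhds_zero_nat
  have hspos : ∀ n, 0 < s n := fun n => by positivity
  have hs1 : ∀ n, |s n| ≤ 1 := fun n => by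
    rw [abs_of_pos (hspos n), hs_def]
    refine (div_le_one (by positivity)).2 ?_
    have : (0 : ℝ) ≤ n := n.cast_nonneg
    linarith
  set νs : ℕ → ProbabilityMeasure (Rd d) := fun n =>
    ⟨mollify (s n) (ν : Measure (Rd d)), inferInstance⟩ with hνs
  have hweak : Tendsto νs atTop (𝓝 ν) := by
    refine ProbabilityMeasure.tendsto_iff_forall_lintegral_tendsto.2 fun f => ?_
    refine tendsto_lintegral_mollify (ν : Measure (Rd d)) hs hs1
      (ENNReal.continuous_coe.comp f.continuous) (G := fun _ => (nndist f 0 : ℝ≥0∞))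
      measurable_const ?_ fun x y _ => ?_
    · simp
    · exact ENNReal.coe_le_coe.2 (BoundedContinuousFunction.NNReal.upper_bound f _)
  have hVint : Tendsto (fun n => ∫⁻ x, ENNReal.ofReal (V x + B) ∂(νs n : Measure (Rd d))) atTop
      (𝓝 (∫⁻ x, ENNReal.ofReal (V x + B) ∂(ν : Measure (Rd d)))) := by
    have hvm : Measurable fun x => ENNReal.ofReal (V x + B) :=
      (hV.measurable.add_const (B : ℝ)).ennreal_ofReal
    refine tendsto_lintegral_mollify (ν : Measure (Rd d)) hs hs1
      (ENNReal.continuous_ofReal.comp (hV.add continuous_const))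
      -- For `|y| ≤ 1`, `V(x + y) ≤ (|x| + 1)² ≤ 2|x|² + 2 ≤ 2V(x) + 2C + 2`, so the majorant has
      -- finite `ν`-integral.
      (G := fun x => 2 * ENNReal.ofReal (V x + B) + ENNReal.ofReal (2 * C + 2 + B))
      ((hvm.const_mul 2).add measurable_const) ?_ fun x y hy => ?_
    · rw [lintegral_add_right _ measurable_const, lintegral_const_mul _ hvm]
      refine ENNReal.add_ne_top.2 ⟨ENNReal.mul_ne_top (by simp) ?_, by simp⟩
      exact ne_top_of_le_ne_top hν le_self_add
    · have h0 : 2 * ENNReal.ofReal (V x + B) = ENNReal.ofReal (2 * (V x + B)) := by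
        rw [ENNReal.ofReal_mul zero_le_two, ENNReal.ofReal_ofNat]
      rw [h0]
      refine le_trans (ENNReal.ofReal_le_ofReal ?_) ENNReal.ofReal_add_le
      have h1 := hVle (x + y)
      have h2 := hVge x
      have h3 : ‖x + y‖ ≤ ‖x‖ + 1 := (norm_add_le x y).trans (by linarith)
      have h4 : ‖x + y‖ ^ 2 ≤ (‖x‖ + 1) ^ 2 := by gcongr
      have h5 : (0 : ℝ) ≤ B := B.2
      nlinarith [sq_nonneg (‖x‖ - 1)]
  refine ⟨νs, fun n => mollify_le (hspos n).ne' _, hweak, tendsto_order.2 ⟨fun a ha => ?_,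
    fun b hb => ?_⟩⟩
  · obtain ⟨M, hM⟩ := ((tendsto_truncatedEnergy_natCast α hV B
      (ν : Measure (Rd d))).eventually_const_lt ha).exists
    filter_upwards [(tendsto_truncatedEnergy α hV B M hweak).eventually_const_lt hM] with n hn
    exact hn.trans_le (truncatedEnergy_le α V B M _)
  · have h1 := hVint.add_const (pairEnergy α (ν : Measure (Rd d)) (ν : Measure (Rd d)) / 2)
    filter_upwards [h1.eventually_lt_const hb] with n hn
    refine lt_of_le_of_lt ?_ hn
    rw [shiftedEnergy]
    gcongr
    exact pairEnergy_conv_le hαd (ν : Measure (Rd d)) _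

lemma continuous_coe_sub_coe (c : ℝ≥0) :
    Continuous fun a : ℝ≥0∞ => (a : EReal) - ((c : ℝ≥0∞) : EReal) := by
  refine continuous_iff_continuousAt.2 fun a => ?_
  have h : ContinuousAt (fun p : EReal × EReal => p.1 + p.2) ((a : EReal), -((c : ℝ≥0∞) : EReal)) := by
    refine EReal.continuousAt_add (Or.inr ?_) (Or.inl (EReal.coe_ennreal_ne_bot _))
    exact EReal.coe_ne_bot (-(c : ℝ))
  exact h.comp (f := fun a : ℝ≥0∞ => ((a : EReal), -((c : ℝ≥0∞) : EReal)))
    ((continuous_coe_ennreal_ereal.prodMk continuous_const).continuousAt)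

theorem energyApproximable_of_quadratic {d : ℕ} {α : ℝ} (hαd : α < d) {V : Rd d → ℝ}
    (hV : Continuous V) {B : ℝ≥0} {C : ℝ} (hVB : ∀ x, 0 ≤ V x + B)
    (hVle : ∀ x, V x ≤ ‖x‖ ^ 2) (hVge : ∀ x, ‖x‖ ^ 2 ≤ V x + C) :
    EnergyApproximable V (rieszInteraction α) := by
  intro ν hν
  simp only [energy_eq_shiftedEnergy α hV.measurable hVB] at hν ⊢
  have hfin : shiftedEnergy α V B (ν : Measure (Rd d)) ≠ ∞ := by
    intro h
    rw [h] at hν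
    exact hν.ne (EReal.top_sub_coe (B : ℝ))
  obtain ⟨νs, hac, hweak, hE⟩ :=
    exists_bounded_density_approximation hαd hV hVle hVge ν hfin
  refine ⟨νs, fun n => ?_, hweak, ((continuous_coe_sub_coe B).tendsto _).comp hE⟩
  obtain ⟨M, hM⟩ := hac n
  exact (Measure.absolutelyContinuous_of_le hM).trans (Measure.smul_absolutelyContinuous)

/-! ### Configurations of nearly minimal energy -/

/-- The Hamiltonian with `V + B` in place of `V`, as a nonnegative extended real. -/
def shiftedHamiltonian {d : ℕ} (α : ℝ) (V : Rd d → ℝ) (B : ℝ≥0) (N : ℕ) (x : Fin N → Rd d) :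
    ℝ≥0∞ :=
  (N : ℝ≥0∞)⁻¹ * ∑ i, ENNReal.ofReal (V (x i) + B) +
    ((N : ℝ≥0∞) ^ 2)⁻¹ *
      ∑ i, ∑ j ∈ Finset.univ.filter (fun j => i < j), rieszKernel α (x i - x j)

lemma measurable_shiftedHamiltonian {d : ℕ} (α : ℝ) {V : Rd d → ℝ} (hV : Measurable V) (B : ℝ≥0)
    (N : ℕ) : Measurable (shiftedHamiltonian α V B N) := by
  unfold shiftedHamiltonian
  refine Measurable.add (Measurable.const_mul (Finset.measurable_sum _ fun i _ => ?_) _)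
    (Measurable.const_mul (Finset.measurable_sum _ fun i _ =>
      Finset.measurable_sum _ fun j _ => ?_) _)
  · exact ((hV.comp (measurable_pi_apply i)).add_const (B : ℝ)).ennreal_ofReal
  · exact (measurable_rieszKernel α).comp ((measurable_pi_apply i).sub (measurable_pi_apply j))

lemma coe_ennreal_sum {ι : Type*} (s : Finset ι) (f : ι → ℝ≥0∞) :
    ((∑ i ∈ s, f i : ℝ≥0∞) : EReal) = ∑ i ∈ s, (f i : EReal) := by
  classical
  induction s using Finset.induction_on with
  | empty => simp
  | insert a s ha ih => rw [Finset.sum_insert ha, Finset.sum_insert ha, EReal.coe_ennreal_add, ih]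

theorem hamiltonian_eq_shiftedHamiltonian {d : ℕ} (α : ℝ) {V : Rd d → ℝ} {B : ℝ≥0}
    (hVB : ∀ x, 0 ≤ V x + B) {N : ℕ} (hN : N ≠ 0) (x : Fin N → Rd d) :
    hamiltonian V (rieszInteraction α) N x =
      ((shiftedHamiltonian α V B N x : ℝ≥0∞) : EReal) - ((B : ℝ≥0∞) : EReal) := by
  have hN0 : (0 : ℝ) < N := by positivity
  have h1 : (((1 / (N : ℝ)) * ∑ i, V (x i) : ℝ) : EReal) =
      (((N : ℝ≥0∞)⁻¹ * ∑ i, ENNReal.ofReal (V (x i) + B) : ℝ≥0∞) : EReal) -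
        ((B : ℝ≥0∞) : EReal) := by
    have hsum : (1 / (N : ℝ)) * ∑ i, V (x i) + B = (N : ℝ)⁻¹ * ∑ i, (V (x i) + B) := by
      rw [Finset.sum_add_distrib, Finset.sum_const, Finset.card_univ, Fintype.card_fin,
        nsmul_eq_mul]
      field_simp
    have hnn : 0 ≤ ∑ i, (V (x i) + B) := Finset.sum_nonneg fun i _ => hVB _
    rw [coe_eq_ofReal_add_sub (B := B) (by rw [hsum]; positivity), hsum,
      ENNReal.ofReal_mul (by positivity), ENNReal.ofReal_inv_of_pos hN0, ENNReal.ofReal_natCast,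
      ENNReal.ofReal_sum_of_nonneg fun i _ => hVB _]
  have h2 : ((1 / (N : ℝ) ^ 2 : ℝ) : EReal) = ((((N : ℝ≥0∞) ^ 2)⁻¹ : ℝ≥0∞) : EReal) := by
    rw [← ENNReal.ofReal_natCast, ← ENNReal.ofReal_pow hN0.le,
      ← ENNReal.ofReal_inv_of_pos (by positivity), EReal.coe_ennreal_ofReal,
      max_eq_left (by positivity), one_div]
  simp only [hamiltonian, shiftedHamiltonian, rieszInteraction]
  rw [h1, h2, ← coe_add_coe_sub, EReal.coe_ennreal_mul (((N : ℝ≥0∞) ^ 2)⁻¹), coe_ennreal_sum]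
  simp only [coe_ennreal_sum]

lemma sum_sum_eq_two_mul_add_diag {N : ℕ} (a : Fin N → Fin N → ℝ≥0∞)
    (ha : ∀ i j, a i j = a j i) :
    ∑ i, ∑ j, a i j =
      2 * ∑ i, ∑ j ∈ Finset.univ.filter (fun j => i < j), a i j + ∑ i, a i i := by
  have h : ∀ i j, a i j = (if i < j then a i j else 0) + (if j < i then a j i else 0) +
      (if i = j then a i j else 0) := by
    intro i j
    rcases lt_trichotomy i j with hij | hij | hij
    · simp [hij, hij.not_gt, hij.ne]
    · simp [hij]
    · simp [hij, hij.not_gt, hij.ne', ha i j]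
  calc ∑ i, ∑ j, a i j = ∑ i, ∑ j, ((if i < j then a i j else 0) + (if j < i then a j i else 0) +
      (if i = j then a i j else 0)) :=
        Finset.sum_congr rfl fun i _ => Finset.sum_congr rfl fun j _ => h i j
    _ = ∑ i, ∑ j, (if i < j then a i j else 0) + ∑ i, ∑ j, (if j < i then a j i else 0) +
        ∑ i, ∑ j, (if i = j then a i j else 0) := by
      simp only [Finset.sum_add_distrib]
    _ = _ := by
      rw [Finset.sum_comm (f := fun i j => if j < i then a j i else 0), ← two_mul]
      simp only [Finset.sum_filter, Finset.sum_ite_eq, Finset.mem_univ, if_true]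

lemma toMeasure_empiricalMeasure {d N : ℕ} (x : Fin N → Rd d) :
    ((empiricalMeasure x : FiniteMeasure (Rd d)) : Measure (Rd d)) =
      ((N : ℝ≥0)⁻¹) • ∑ i, Measure.dirac (x i) := by
  rw [empiricalMeasure, FiniteMeasure.toMeasure_smul, FiniteMeasure.toMeasure_sum]
  rfl

lemma lintegral_empiricalMeasure {d N : ℕ} (hN : N ≠ 0) (x : Fin N → Rd d) (g : Rd d → ℝ≥0∞) :
    ∫⁻ y, g y ∂((empiricalMeasure x : FiniteMeasure (Rd d)) : Measure (Rd d)) =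
      (N : ℝ≥0∞)⁻¹ * ∑ i, g (x i) := by
  have hN' : (N : ℝ≥0) ≠ 0 := by exact_mod_cast hN
  rw [toMeasure_empiricalMeasure, lintegral_smul_measure, lintegral_finsetSum_measure]
  simp only [lintegral_dirac, ENNReal.smul_def, smul_eq_mul, ENNReal.coe_inv hN',
    ENNReal.coe_natCast]

lemma isProbabilityMeasure_empiricalMeasure {d N : ℕ} (hN : N ≠ 0) (x : Fin N → Rd d) :
    IsProbabilityMeasure ((empiricalMeasure x : FiniteMeasure (Rd d)) : Measure (Rd d)) := by
  refine ⟨?_⟩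
  have h := lintegral_empiricalMeasure hN x fun _ => 1
  rw [lintegral_const, one_mul] at h
  rw [h, Finset.sum_const, Finset.card_univ, Fintype.card_fin, nsmul_eq_mul, mul_one]
  exact ENNReal.inv_mul_cancel (by exact_mod_cast hN) (ENNReal.natCast_ne_top N)

/-- The full self-energy of an empirical measure is infinite because of the diagonal. Truncation at
`M` makes the `N` diagonal terms cost at most `M/(2N)` after normalization. -/
theorem truncatedEnergy_empiricalMeasure_le {d : ℕ} (α : ℝ) (V : Rd d → ℝ) (B M : ℝ≥0) {N : ℕ}
    (hN : N ≠ 0) (x : Fin N → Rd d) :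
    truncatedEnergy α V B M ((empiricalMeasure x : FiniteMeasure (Rd d)) : Measure (Rd d)) ≤
      shiftedHamiltonian α V B N x + M / N := by
  have hk : Measurable fun q : Rd d × Rd d => min (rieszKernel α (q.1 - q.2)) M :=
    (measurable_rieszKernel_sub α).min measurable_const
  rw [truncatedEnergy, lintegral_prod (fun q : Rd d × Rd d => min (rieszKernel α (q.1 - q.2)) M)
    hk.aemeasurable]
  simp only [lintegral_empiricalMeasure hN]
  rw [← Finset.mul_sum, sum_sum_eq_two_mul_add_diag _
    fun i j => by rw [rieszKernel_sub_comm α (x i) (x j)], shiftedHamiltonian, add_assoc]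
  refine add_le_add ?_ ?_
  · gcongr
    exact min_le_left _ _
  · have hN0 : (N : ℝ≥0∞) ≠ 0 := by exact_mod_cast hN
    have hNtop : (N : ℝ≥0∞) ≠ ∞ := ENNReal.natCast_ne_top N
    have hdiag : ∑ i, min (rieszKernel α (x i - x i)) (M : ℝ≥0∞) ≤ N * M := by
      calc ∑ i, min (rieszKernel α (x i - x i)) (M : ℝ≥0∞) ≤ ∑ _i : Fin N, (M : ℝ≥0∞) :=
            Finset.sum_le_sum fun i _ => min_le_right _ _
        _ = N * M := by simp
    have hoff : ∑ i, ∑ j ∈ Finset.univ.filter (fun j => i < j),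
        min (rieszKernel α (x i - x j)) (M : ℝ≥0∞) ≤
        ∑ i, ∑ j ∈ Finset.univ.filter (fun j => i < j), rieszKernel α (x i - x j) :=
      Finset.sum_le_sum fun i _ => Finset.sum_le_sum fun j _ => min_le_left _ _
    set S := ∑ i, ∑ j ∈ Finset.univ.filter (fun j => i < j), rieszKernel α (x i - x j)
    calc _ ≤ ((N : ℝ≥0∞)⁻¹ * ((N : ℝ≥0∞)⁻¹ * (2 * S + N * M))) / 2 := by gcongr
      _ = ((N : ℝ≥0∞) ^ 2)⁻¹ * S * (2 * 2⁻¹) +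
          (N : ℝ≥0∞)⁻¹ * ((N : ℝ≥0∞)⁻¹ * N) * M * 2⁻¹ := by
        rw [ENNReal.div_eq_inv_mul, sq, ENNReal.mul_inv (Or.inl hN0) (Or.inl hNtop)]
        ring
      _ = ((N : ℝ≥0∞) ^ 2)⁻¹ * S + M / N * 2⁻¹ := by
        rw [ENNReal.mul_inv_cancel (by simp) (by simp), ENNReal.inv_mul_cancel hN0 hNtop, mul_one,
          mul_one, ENNReal.div_eq_inv_mul]
      _ ≤ ((N : ℝ≥0∞) ^ 2)⁻¹ * S + M / N := by
        gcongr
        exact mul_le_of_le_one_right zero_le (ENNReal.inv_le_one.2 (by norm_num))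

lemma isCompact_closure_setOf_lintegral_le {d : ℕ} {V : Rd d → ℝ} (hV : Continuous V)
    (hVtop : Tendsto V (cocompact (Rd d)) atTop) (B : ℝ≥0) {C : ℝ≥0∞} (hC : C ≠ ∞) :
    IsCompact (closure {ν : ProbabilityMeasure (Rd d) |
      ∫⁻ x, ENNReal.ofReal (V x + B) ∂(ν : Measure (Rd d)) ≤ C}) := by
  refine isCompact_closure_of_isTightMeasureSet
    (isTightMeasureSet_iff_exists_isCompact_measure_compl_le.2 fun ε hε => ?_)
  obtain ⟨n, hn⟩ := ((ENNReal.Tendsto.const_div ENNReal.tendsto_nat_nhds_top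
    (Or.inr hC)).eventually_lt_const (by simpa using hε)).exists
  -- The level `n + 1` keeps the divisor in Markov's inequality nonzero even for `n = 0`.
  obtain ⟨K, hK, hKV⟩ := mem_cocompact.1 (hVtop.eventually_ge_atTop ((n : ℝ) + 1))
  refine ⟨K, hK, ?_⟩
  rintro _ ⟨ν, hν, rfl⟩
  have hν' : ∫⁻ x, ENNReal.ofReal (V x + B) ∂(ν : Measure (Rd d)) ≤ C := hν
  have hsub : Kᶜ ⊆ {x | ((n : ℝ≥0∞) + 1) ≤ ENNReal.ofReal (V x + B)} := by
    intro x hx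
    have h1 : (n : ℝ) + 1 ≤ V x := hKV hx
    have h2 : (0 : ℝ) ≤ B := B.2
    show ((n : ℝ≥0∞) + 1) ≤ ENNReal.ofReal (V x + B)
    rw [show ((n : ℝ≥0∞) + 1) = ENNReal.ofReal ((n : ℝ) + 1) by
      rw [ENNReal.ofReal_add (by positivity) zero_le_one]; simp]
    exact ENNReal.ofReal_le_ofReal (by linarith)
  calc (ν : Measure (Rd d)) Kᶜ
      ≤ (ν : Measure (Rd d)) {x | ((n : ℝ≥0∞) + 1) ≤ ENNReal.ofReal (V x + B)} :=
        measure_mono hsub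
    _ ≤ (∫⁻ x, ENNReal.ofReal (V x + B) ∂(ν : Measure (Rd d))) / ((n : ℝ≥0∞) + 1) :=
        meas_ge_le_lintegral_div
          (hV.measurable.add_const (B : ℝ)).ennreal_ofReal.aemeasurable (by simp) (by simp)
    _ ≤ C / n := by
        gcongr
        exact le_self_add
    _ ≤ ε := hn.le

/-- Bounded energy gives tightness, so it suffices to identify cluster points. Along an ultrafilter
converging to one, each truncated energy passes to the limit and is at most the minimum; letting the
truncation grow makes the cluster point a minimizer. -/
theorem tendsto_empiricalMeasure_of_shiftedHamiltonian_le {d : ℕ} {α : ℝ} {V : Rd d → ℝ}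
    (hV : Continuous V) (hVtop : Tendsto V (cocompact (Rd d)) atTop) {B : ℝ≥0}
    (μ : ProbabilityMeasure (Rd d)) (hμ : shiftedEnergy α V B (μ : Measure (Rd d)) ≠ ∞)
    (huniq : ∀ ν : ProbabilityMeasure (Rd d), shiftedEnergy α V B (ν : Measure (Rd d)) ≤
      shiftedEnergy α V B (μ : Measure (Rd d)) → ν = μ)
    (x : (N : ℕ) → Fin N → Rd d)
    (hx : ∀ δ : ℝ≥0, 0 < δ → ∀ᶠ N in atTop, shiftedHamiltonian α V B N (x N) ≤
      shiftedEnergy α V B (μ : Measure (Rd d)) + δ) :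
    Tendsto (fun N => empiricalMeasure (x N)) atTop (𝓝 μ.toFiniteMeasure) := by
  set J := shiftedEnergy α V B (μ : Measure (Rd d))
  set ν : ℕ → ProbabilityMeasure (Rd d) := fun N =>
    if hN : N = 0 then μ else
      ⟨(empiricalMeasure (x N) : Measure (Rd d)), isProbabilityMeasure_empiricalMeasure hN (x N)⟩
  have hν : ∀ N, N ≠ 0 → (ν N : Measure (Rd d)) =
      ((empiricalMeasure (x N) : FiniteMeasure (Rd d)) : Measure (Rd d)) := by
    intro N hN
    have h : ν N = ⟨(empiricalMeasure (x N) : Measure (Rd d)),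
      isProbabilityMeasure_empiricalMeasure hN (x N)⟩ := dif_neg hN
    rw [h]
    rfl
  suffices h : Tendsto ν atTop (𝓝 μ) by
    have h2 := (ProbabilityMeasure.tendsto_nhds_iff_toFiniteMeasure_tendsto_nhds atTop).1 h
    refine h2.congr' ?_
    filter_upwards [eventually_ne_atTop 0] with N hN
    exact Subtype.ext (hν N hN)
  have hJ1 : J + 1 ≠ ∞ := ENNReal.add_ne_top.2 ⟨hμ, ENNReal.one_ne_top⟩
  refine (isCompact_closure_setOf_lintegral_le hV hVtop B hJ1).tendsto_nhds_of_unique_mapClusterPt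
    ?_ fun η _ hη => huniq η ?_
  · filter_upwards [hx 1 one_pos, eventually_ne_atTop 0] with N hN hN0
    refine subset_closure ?_
    show ∫⁻ x, ENNReal.ofReal (V x + B) ∂(ν N : Measure (Rd d)) ≤ J + 1
    rw [hν N hN0, lintegral_empiricalMeasure hN0]
    refine le_trans ?_ hN
    exact le_self_add
  · obtain ⟨U, hU, hUη⟩ := mapClusterPt_iff_ultrafilter.1 hη
    refine le_of_tendsto' (tendsto_truncatedEnergy_natCast α hV B (η : Measure (Rd d))) fun M => ?_
    refine ENNReal.le_of_forall_pos_le_add fun ε hε _ => ?_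
    have hMN : ∀ᶠ N : ℕ in atTop, ((M : ℝ≥0) : ℝ≥0∞) / N < ((ε / 2 : ℝ≥0) : ℝ≥0∞) :=
      (ENNReal.Tendsto.const_div ENNReal.tendsto_nat_nhds_top
        (Or.inr ENNReal.coe_ne_top)).eventually_lt_const
          (by rw [ENNReal.div_top]; exact_mod_cast half_pos hε)
    refine le_of_tendsto (tendsto_truncatedEnergy α hV B M hUη) (hU ?_)
    filter_upwards [hMN, hx (ε / 2) (half_pos hε), eventually_ne_atTop 0] with N h1 h2 hN
    rw [hν N hN]
    calc _ ≤ shiftedHamiltonian α V B N (x N) + ((M : ℝ≥0) : ℝ≥0∞) / N :=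
          truncatedEnergy_empiricalMeasure_le α V B M hN (x N)
      _ ≤ (J + ((ε / 2 : ℝ≥0) : ℝ≥0∞)) + ((ε / 2 : ℝ≥0) : ℝ≥0∞) := add_le_add h2 h1.le
      _ = J + ε := by
        rw [add_assoc, ← ENNReal.coe_add, add_halves]

/-! ### The Boltzmann weight -/

lemma le_boltzmannWeight {d : ℕ} {α : ℝ} {V : Rd d → ℝ} {B : ℝ≥0} (hVB : ∀ x, 0 ≤ V x + B)
    {N : ℕ} (hN : N ≠ 0) {β : ℝ} (hβ : 0 ≤ β) {x : Fin N → Rd d} {c : ℝ≥0}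
    (hx : shiftedHamiltonian α V B N x ≤ c) :
    ENNReal.ofReal (Real.exp (-(β * (c - B)))) ≤
      boltzmannWeight V (rieszInteraction α) β N x := by
  rw [boltzmannWeight, hamiltonian_eq_shiftedHamiltonian α hVB hN]
  have hne : shiftedHamiltonian α V B N x ≠ ∞ := ne_top_of_le_ne_top ENNReal.coe_ne_top hx
  generalize shiftedHamiltonian α V B N x = h at hx hne
  lift h to ℝ≥0 using hne
  have hx' : (h : ℝ) ≤ c := by exact_mod_cast hx
  have : (-((β : EReal) * (((h : ℝ≥0∞) : EReal) - ((B : ℝ≥0∞) : EReal)))) =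
      ((-(β * ((h : ℝ) - B)) : ℝ) : EReal) := by
    rw [EReal.coe_neg, EReal.coe_mul, EReal.coe_sub]
    rfl
  rw [this, EReal.exp_coe]
  gcongr

/-- Of the inverse temperature, `β - N` is spent on the lower bound `c` for the energy; the
remaining `N` uses the potential part alone and yields the integrable factor `∏ exp(-V)`. -/
lemma boltzmannWeight_le {d : ℕ} {α : ℝ} {V : Rd d → ℝ} {B : ℝ≥0} (hVB : ∀ x, 0 ≤ V x + B)
    {N : ℕ} (hN : N ≠ 0) {β : ℝ} (hβ : (N : ℝ) ≤ β) {x : Fin N → Rd d} {c : ℝ≥0}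
    (hx : c ≤ shiftedHamiltonian α V B N x) :
    boltzmannWeight V (rieszInteraction α) β N x ≤
      ENNReal.ofReal (Real.exp (-((β - N) * (c - B)))) *
        ENNReal.ofReal (∏ i, Real.exp (-V (x i))) := by
  have hN0 : (0 : ℝ) < N := by positivity
  rw [boltzmannWeight, hamiltonian_eq_shiftedHamiltonian α hVB hN]
  have hsum : (N : ℝ≥0∞)⁻¹ * ∑ i, ENNReal.ofReal (V (x i) + B) ≤ shiftedHamiltonian α V B N x :=
    le_self_add
  generalize shiftedHamiltonian α V B N x = h at hx hsum
  induction h with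
  | top =>
    have h1 : ((∞ : ℝ≥0∞) : EReal) - ((B : ℝ≥0∞) : EReal) = ⊤ := EReal.top_sub_coe (B : ℝ)
    rw [h1, EReal.coe_mul_top_of_pos (hN0.trans_le hβ), EReal.neg_top, EReal.exp_bot]
    exact zero_le
  | coe h =>
    have hx' : (c : ℝ) ≤ h := by exact_mod_cast hx
    have hsum' : (N : ℝ)⁻¹ * ∑ i, (V (x i) + B) ≤ h := by
      rw [← ENNReal.ofReal_sum_of_nonneg fun i _ => hVB _, ← ENNReal.ofReal_natCast,
        ← ENNReal.ofReal_inv_of_pos hN0, ← ENNReal.ofReal_mul (by positivity),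
        ← ENNReal.ofReal_coe_nnreal] at hsum
      exact (ENNReal.ofReal_le_ofReal_iff h.2).1 hsum
    rw [inv_mul_le_iff₀ hN0, Finset.sum_add_distrib, Finset.sum_const, Finset.card_univ,
      Fintype.card_fin, nsmul_eq_mul] at hsum'
    have : (-((β : EReal) * (((h : ℝ≥0∞) : EReal) - ((B : ℝ≥0∞) : EReal)))) =
        ((-(β * ((h : ℝ) - B)) : ℝ) : EReal) := by
      rw [EReal.coe_neg, EReal.coe_mul, EReal.coe_sub]
      rfl
    rw [this, EReal.exp_coe, ← ENNReal.ofReal_mul (Real.exp_pos _).le, ← Real.exp_sum,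
      ← Real.exp_add]
    refine ENNReal.ofReal_le_ofReal (Real.exp_le_exp.2 ?_)
    rw [Finset.sum_neg_distrib]
    have h3 : (β - N) * c ≤ (β - N) * h := mul_le_mul_of_nonneg_left hx' (by linarith)
    nlinarith

lemma lintegral_prod_exp_neg {d : ℕ} {V : Rd d → ℝ}
    (hint : Integrable (fun x => Real.exp (-V x)) volume) (N : ℕ) :
    ∫⁻ x : Fin N → Rd d, ENNReal.ofReal (∏ i, Real.exp (-V (x i))) =
      ENNReal.ofReal (∫ x, Real.exp (-V x)) ^ N := by
  have h1 : Integrable (fun x : Fin N → Rd d => ∏ i, Real.exp (-V (x i))) :=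
    Integrable.fintype_prod (f := fun _ x => Real.exp (-V x)) fun _ => hint
  rw [← ofReal_integral_eq_lintegral_ofReal h1
    (ae_of_all _ fun x => Finset.prod_nonneg fun i _ => (Real.exp_pos _).le),
    integral_fintype_prod_volume_eq_pow (fun x => Real.exp (-V x)), Fintype.card_fin,
    ENNReal.ofReal_pow (integral_nonneg fun _ => (Real.exp_pos _).le)]

lemma setLIntegral_boltzmannWeight_le {d : ℕ} {α : ℝ} {V : Rd d → ℝ} (hVm : Measurable V)
    {B : ℝ≥0} (hVB : ∀ x, 0 ≤ V x + B) (hint : Integrable (fun x => Real.exp (-V x)) volume)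
    {N : ℕ} (hN : N ≠ 0) {β : ℝ} (hβ : (N : ℝ) ≤ β) (c : ℝ≥0) :
    ∫⁻ x in {x | (c : ℝ≥0∞) ≤ shiftedHamiltonian α V B N x},
        boltzmannWeight V (rieszInteraction α) β N x ≤
      ENNReal.ofReal (Real.exp (-((β - N) * (c - B)))) *
        ENNReal.ofReal (∫ x, Real.exp (-V x)) ^ N := by
  have hmeas : MeasurableSet {x | (c : ℝ≥0∞) ≤ shiftedHamiltonian α V B N x} :=
    measurableSet_le measurable_const (measurable_shiftedHamiltonian α hVm B N)
  refine (setLIntegral_mono' hmeas fun x hx => boltzmannWeight_le hVB hN hβ hx).trans ?_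
  refine (setLIntegral_le_lintegral _ _).trans ?_
  rw [lintegral_const_mul' _ _ ENNReal.ofReal_ne_top, lintegral_prod_exp_neg hint]

theorem partitionFunction_lt_top {d : ℕ} {α : ℝ} {V : Rd d → ℝ} (hVm : Measurable V)
    {B : ℝ≥0} (hVB : ∀ x, 0 ≤ V x + B) (hint : Integrable (fun x => Real.exp (-V x)) volume)
    {N : ℕ} (hN : N ≠ 0) {β : ℝ} (hβ : (N : ℝ) ≤ β) :
    partitionFunction V (rieszInteraction α) β N < ∞ := by
  have h := setLIntegral_boltzmannWeight_le (α := α) hVm hVB hint hN hβ 0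
  have huniv : {x | ((0 : ℝ≥0) : ℝ≥0∞) ≤ shiftedHamiltonian α V B N x} = Set.univ := by
    ext x
    simp
  rw [huniv, Measure.restrict_univ] at h
  exact h.trans_lt (ENNReal.mul_lt_top ENNReal.ofReal_lt_top
    (ENNReal.pow_lt_top ENNReal.ofReal_lt_top))

/-! ### Lower bound on the partition function -/

/-- The bound is immediate on boxes, and extends because the product outer measure is the largest
one dominated by the box volumes. -/
lemma pi_le_of_le_smul {d : ℕ} {η : Measure (Rd d)} [IsProbabilityMeasure η] {M : ℝ≥0}
    (hη : η ≤ M • (volume : Measure (Rd d))) (N : ℕ) {A : Set (Fin N → Rd d)}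
    (hA : MeasurableSet A) :
    Measure.pi (fun _ : Fin N => η) A ≤ (M : ℝ≥0∞) ^ N * volume A := by
  have hM : M ≠ 0 := by
    rintro rfl
    have h := hη Set.univ
    simp at h
  have hMN : (M : ℝ≥0∞) ^ N ≠ 0 := pow_ne_zero _ (by exact_mod_cast hM)
  have hMNtop : (M : ℝ≥0∞) ^ N ≠ ∞ := ENNReal.pow_ne_top ENNReal.coe_ne_top
  have hle : ((M : ℝ≥0∞) ^ N)⁻¹ • (Measure.pi (fun _ : Fin N => η)).toOuterMeasure ≤
      OuterMeasure.pi fun _ : Fin N => (volume : Measure (Rd d)).toOuterMeasure := by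
    refine OuterMeasure.le_pi.2 fun s _ => ?_
    show ((M : ℝ≥0∞) ^ N)⁻¹ * Measure.pi (fun _ : Fin N => η) (Set.pi Set.univ s) ≤
      ∏ i, volume (s i)
    rw [Measure.pi_pi]
    calc ((M : ℝ≥0∞) ^ N)⁻¹ * ∏ i, η (s i)
        ≤ ((M : ℝ≥0∞) ^ N)⁻¹ * ∏ i, ((M : ℝ≥0∞) * volume (s i)) := by
          gcongr with i
          exact hη (s i)
      _ = ∏ i, volume (s i) := by
          rw [Finset.prod_mul_distrib, Finset.prod_const, Finset.card_univ, Fintype.card_fin,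
            ← mul_assoc, ENNReal.inv_mul_cancel hMN hMNtop, one_mul]
  have h1 : ((M : ℝ≥0∞) ^ N)⁻¹ * Measure.pi (fun _ : Fin N => η) A ≤ volume A := by
    refine (hle A).trans_eq ?_
    rw [volume_pi, Measure.pi, toMeasure_apply _ _ hA]
  rwa [ENNReal.inv_mul_le_iff hMN hMNtop] at h1

lemma lintegral_pi_eval {d : ℕ} (η : Measure (Rd d)) [IsProbabilityMeasure η] {N : ℕ} (i : Fin N)
    {g : Rd d → ℝ≥0∞} (hg : Measurable g) :
    ∫⁻ x, g (x i) ∂(Measure.pi (fun _ : Fin N => η)) = ∫⁻ y, g y ∂η :=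
  (measurePreserving_eval (fun _ : Fin N => η) i).lintegral_comp hg

lemma lintegral_pi_eval_pair {d : ℕ} (η : Measure (Rd d)) [IsProbabilityMeasure η] {N : ℕ}
    {i j : Fin N} (hij : i ≠ j) {g : Rd d × Rd d → ℝ≥0∞} (hg : Measurable g) :
    ∫⁻ x, g (x i, x j) ∂(Measure.pi (fun _ : Fin N => η)) = ∫⁻ q, g q ∂(η.prod η) := by
  have hind : IndepFun (fun x : Fin N → Rd d => x i) (fun x => x j)
      (Measure.pi (fun _ : Fin N => η)) :=
    (iIndepFun_pi (μ := fun _ : Fin N => η) (X := fun _ => id)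
      fun _ => aemeasurable_id).indepFun hij
  have hmap := hind.map_prod_eq_prod_map_map (measurable_pi_apply i).aemeasurable
    (measurable_pi_apply j).aemeasurable
  have hi : (Measure.pi (fun _ : Fin N => η)).map (fun x => x i) = η :=
    (measurePreserving_eval (fun _ : Fin N => η) i).map_eq
  have hj : (Measure.pi (fun _ : Fin N => η)).map (fun x => x j) = η :=
    (measurePreserving_eval (fun _ : Fin N => η) j).map_eq
  rw [hi, hj] at hmap
  rw [← hmap, lintegral_map hg ((measurable_pi_apply i).prodMk (measurable_pi_apply j))]

/-- Under independent sampling each of the `N(N-1)/2 ≤ N²/2` pairs contributes exactly the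
self-energy. -/
theorem lintegral_shiftedHamiltonian_le {d : ℕ} (α : ℝ) {V : Rd d → ℝ} (hVm : Measurable V)
    (B : ℝ≥0) (η : Measure (Rd d)) [IsProbabilityMeasure η] {N : ℕ} (hN : N ≠ 0) :
    ∫⁻ x, shiftedHamiltonian α V B N x ∂(Measure.pi (fun _ : Fin N => η)) ≤
      shiftedEnergy α V B η := by
  have hN0 : (N : ℝ≥0∞) ≠ 0 := by exact_mod_cast hN
  have hNtop : (N : ℝ≥0∞) ≠ ∞ := ENNReal.natCast_ne_top N
  have hvm : Measurable fun x => ENNReal.ofReal (V x + B) :=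
    (hVm.add_const (B : ℝ)).ennreal_ofReal
  have hvi : ∀ i : Fin N, Measurable fun x : Fin N → Rd d => ENNReal.ofReal (V (x i) + B) :=
    fun i => hvm.comp (measurable_pi_apply i)
  have hkij : ∀ i j : Fin N, Measurable fun x : Fin N → Rd d => rieszKernel α (x i - x j) :=
    fun i j => (measurable_rieszKernel α).comp ((measurable_pi_apply i).sub (measurable_pi_apply j))
  simp only [shiftedHamiltonian]
  rw [lintegral_add_left ((Finset.measurable_sum _ fun i _ => hvi i).const_mul _),
    lintegral_const_mul _ (Finset.measurable_sum _ fun i _ => hvi i),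
    lintegral_const_mul _ (Finset.measurable_sum _ fun i _ =>
      Finset.measurable_sum _ fun j _ => hkij i j),
    lintegral_finsetSum _ fun i _ => hvi i,
    lintegral_finsetSum _ fun i _ => Finset.measurable_sum _ fun j _ => hkij i j, shiftedEnergy]
  refine add_le_add ?_ ?_
  · simp only [lintegral_pi_eval η _ hvm]
    rw [Finset.sum_const, Finset.card_univ, Fintype.card_fin, nsmul_eq_mul, ← mul_assoc,
      ENNReal.inv_mul_cancel hN0 hNtop, one_mul]
  · have h1 : ∀ i : Fin N, ∫⁻ x, ∑ j ∈ Finset.univ.filter (fun j => i < j),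
        rieszKernel α (x i - x j) ∂(Measure.pi (fun _ : Fin N => η)) =
        ∑ j ∈ Finset.univ.filter (fun j => i < j), pairEnergy α η η := by
      intro i
      rw [lintegral_finsetSum _ fun j _ => hkij i j]
      refine Finset.sum_congr rfl fun j hj => ?_
      rw [pairEnergy_eq_lintegral_prod]
      exact lintegral_pi_eval_pair η (Finset.mem_filter.1 hj).2.ne (measurable_rieszKernel_sub α)
    simp only [h1]
    have h2 := sum_sum_eq_two_mul_add_diag (N := N) (fun _ _ => pairEnergy α η η)
      (fun _ _ => rfl)
    have h3 : 2 * ∑ i : Fin N, ∑ j ∈ Finset.univ.filter (fun j => i < j), pairEnergy α η η ≤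
        (N : ℝ≥0∞) ^ 2 * pairEnergy α η η := by
      calc _ ≤ ∑ _i : Fin N, ∑ _j : Fin N, pairEnergy α η η := by
            rw [h2]
            exact le_self_add
        _ = (N : ℝ≥0∞) ^ 2 * pairEnergy α η η := by
            simp only [Finset.sum_const, Finset.card_univ, Fintype.card_fin, nsmul_eq_mul]
            ring
    rw [ENNReal.inv_mul_le_iff (pow_ne_zero _ hN0) (ENNReal.pow_ne_top hNtop), mul_div_assoc',
      ENNReal.le_div_iff_mul_le (by simp) (by simp), mul_comm]
    exact h3

/-- By Markov's inequality, configurations sampled from `η` have Hamiltonian at most `c` with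
probability at least `1 - J(η)/c`, where `J` is the shifted energy. The density bound converts this
into Lebesgue volume, at the price `M ^ N`, and the weight is bounded below there. The bound has
content when `J(η) < c`. -/
theorem le_partitionFunction {d : ℕ} {α : ℝ} {V : Rd d → ℝ} (hVm : Measurable V)
    {B : ℝ≥0} (hVB : ∀ x, 0 ≤ V x + B) {η : Measure (Rd d)} [IsProbabilityMeasure η] {M c : ℝ≥0}
    (hη : η ≤ M • (volume : Measure (Rd d))) (hc : c ≠ 0) {N : ℕ} (hN : N ≠ 0) {β : ℝ}
    (hβ : 0 ≤ β) :
    (1 - shiftedEnergy α V B η / c) * ENNReal.ofReal (Real.exp (-(β * (c - B)))) ≤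
      (M : ℝ≥0∞) ^ N * partitionFunction V (rieszInteraction α) β N := by
  set A : Set (Fin N → Rd d) := {x | shiftedHamiltonian α V B N x ≤ c} with hA_def
  have hm := measurable_shiftedHamiltonian α hVm B N
  have hA : MeasurableSet A := measurableSet_le hm measurable_const
  have hAc : Measure.pi (fun _ : Fin N => η) Aᶜ ≤ shiftedEnergy α V B η / c := by
    calc _ ≤ Measure.pi (fun _ : Fin N => η) {x | (c : ℝ≥0∞) ≤ shiftedHamiltonian α V B N x} := by
          refine measure_mono fun x hx => ?_
          exact (not_le.1 (show ¬ shiftedHamiltonian α V B N x ≤ c from hx)).le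
      _ ≤ (∫⁻ x, shiftedHamiltonian α V B N x ∂(Measure.pi (fun _ : Fin N => η))) / c :=
          meas_ge_le_lintegral_div hm.aemeasurable (by exact_mod_cast hc) ENNReal.coe_ne_top
      _ ≤ shiftedEnergy α V B η / c := by
          gcongr
          exact lintegral_shiftedHamiltonian_le α hVm B η hN
  have hAge : 1 - shiftedEnergy α V B η / c ≤ Measure.pi (fun _ : Fin N => η) A := by
    rw [tsub_le_iff_right, ← measure_univ (μ := Measure.pi (fun _ : Fin N => η)),
      ← measure_add_measure_compl hA]
    gcongr
  calc _ ≤ ((M : ℝ≥0∞) ^ N * volume A) * ENNReal.ofReal (Real.exp (-(β * (c - B)))) := by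
        gcongr
        exact hAge.trans (pi_le_of_le_smul hη N hA)
    _ = (M : ℝ≥0∞) ^ N * ∫⁻ _ in A, ENNReal.ofReal (Real.exp (-(β * (c - B)))) := by
        rw [setLIntegral_const]
        ring
    _ ≤ (M : ℝ≥0∞) ^ N * ∫⁻ x in A, boltzmannWeight V (rieszInteraction α) β N x := by
        exact mul_le_mul' le_rfl
          (setLIntegral_mono' hA fun x hx => le_boltzmannWeight hVB hN hβ hx)
    _ ≤ _ := by
        gcongr
        exact setLIntegral_le_lintegral _ _

/-! ### Concentration of the Gibbs measure on low energies -/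

/-- Since `log N ≥ 1` for `N ≥ 3`, the growth hypothesis yields `β_N / N → ∞`, the form in which the
concentration argument consumes it. -/
lemma eventually_mul_le_of_tendsto_div_log {β : ℕ → ℝ}
    (hβ : Tendsto (fun N : ℕ => β N / (N * Real.log N)) atTop atTop) (L : ℝ) :
    ∀ᶠ N : ℕ in atTop, L * N ≤ β N := by
  filter_upwards [hβ.eventually_ge_atTop |L|, eventually_ge_atTop 3] with N h hN
  have hN' : (3 : ℝ) ≤ N := by exact_mod_cast hN
  have hlog : 1 ≤ Real.log N := by
    rw [Real.le_log_iff_exp_le (by linarith)]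
    exact Real.exp_one_lt_d9.le.trans (by linarith)
  rw [le_div_iff₀ (by positivity)] at h
  calc L * N ≤ |L| * N := by
        gcongr
        exact le_abs_self L
    _ ≤ |L| * (N * Real.log N) := by
        gcongr
        exact le_mul_of_one_le_right (by positivity) hlog
    _ ≤ β N := h

/-- The hypothesis gives `exp(-βδ) ≤ (2q + 1)^(-N)`, and `q/(2q + 1) ≤ 1/2`; the `+ 1` keeps the
logarithm's argument positive when `q = 0`. -/
lemma exp_neg_mul_pow_le {q β δ : ℝ} (hq : 0 ≤ q) {N : ℕ}
    (h : Real.log (2 * q + 1) * N ≤ β * δ) :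
    Real.exp (-(β * δ)) * q ^ N ≤ (1 / 2) ^ N := by
  have h1 : Real.exp (-(β * δ)) ≤ ((2 * q + 1) ^ N)⁻¹ := by
    rw [← Real.exp_log (x := ((2 * q + 1) ^ N)⁻¹) (by positivity), Real.log_inv, Real.log_pow]
    exact Real.exp_le_exp.2 (by linarith)
  calc Real.exp (-(β * δ)) * q ^ N ≤ ((2 * q + 1) ^ N)⁻¹ * q ^ N := by gcongr
    _ = (q / (2 * q + 1)) ^ N := by rw [div_pow, div_eq_inv_mul]
    _ ≤ (1 / 2) ^ N := by
        refine pow_le_pow_left₀ (by positivity) ?_ N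
        rw [div_le_div_iff₀ (by linarith) two_pos]
        linarith

/-- Dividing the upper bound at level `c + δ` by the lower bound at level `c` leaves `exp(-βδ)`
times the `N`-th power of a constant, which `hβδ` makes at most `2^(-N)`. -/
theorem gibbsMeasure_le {d : ℕ} {α : ℝ} {V : Rd d → ℝ} (hVm : Measurable V)
    {B : ℝ≥0} (hVB : ∀ x, 0 ≤ V x + B) (hint : Integrable (fun x => Real.exp (-V x)) volume)
    {η : Measure (Rd d)} [IsProbabilityMeasure η] {M c δ : ℝ≥0}
    (hη : η ≤ M • (volume : Measure (Rd d))) (hc : shiftedEnergy α V B η < c) {N : ℕ}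
    (hN : N ≠ 0) {β : ℝ} (hβ : (N : ℝ) ≤ β)
    (hβδ : Real.log (2 * (M * (∫ x, Real.exp (-V x)) * Real.exp (c + δ - B)) + 1) * N ≤ β * δ) :
    0 < partitionFunction V (rieszInteraction α) β N ∧
    gibbsMeasure V (rieszInteraction α) β N
        {x | ((c + δ : ℝ≥0) : ℝ≥0∞) ≤ shiftedHamiltonian α V B N x} ≤
      (1 - shiftedEnergy α V B η / c)⁻¹ * 2⁻¹ ^ N := by
  set Z := partitionFunction V (rieszInteraction α) β N with hZ_def
  set κ := 1 - shiftedEnergy α V B η / c with hκ_def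
  have hc0 : c ≠ 0 := by
    rintro rfl
    simp at hc
  have hκ0 : κ ≠ 0 := by
    rw [hκ_def, Ne, tsub_eq_zero_iff_le, not_le]
    exact ENNReal.div_lt_of_lt_mul (by simpa using hc)
  have hκtop : κ ≠ ∞ := ne_top_of_le_ne_top ENNReal.one_ne_top tsub_le_self
  have hβ0 : 0 ≤ β := (Nat.cast_nonneg N).trans hβ
  have hlow := le_partitionFunction (α := α) hVm hVB hη hc0 hN hβ0
  rw [← hZ_def, ← hκ_def] at hlow
  have hZ0 : Z ≠ 0 := by
    intro h
    rw [h, mul_zero, nonpos_iff_eq_zero, mul_eq_zero] at hlow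
    rcases hlow with h | h
    · exact hκ0 h
    · exact (ENNReal.ofReal_pos.2 (Real.exp_pos _)).ne' h
  have hZtop : Z ≠ ∞ := (partitionFunction_lt_top hVm hVB hint hN hβ).ne
  refine ⟨pos_iff_ne_zero.2 hZ0, ?_⟩
  have hmeas : MeasurableSet {x | ((c + δ : ℝ≥0) : ℝ≥0∞) ≤ shiftedHamiltonian α V B N x} :=
    measurableSet_le measurable_const (measurable_shiftedHamiltonian α hVm B N)
  rw [gibbsMeasure, Measure.smul_apply, withDensity_apply _ hmeas, smul_eq_mul, ← hZ_def,
    ENNReal.inv_mul_le_iff hZ0 hZtop]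
  refine (setLIntegral_boltzmannWeight_le hVm hVB hint hN hβ _).trans ?_
  set D := ∫ x, Real.exp (-V x) with hD_def
  have hD : 0 ≤ D := integral_nonneg fun _ => (Real.exp_pos _).le
  set R : ℝ≥0∞ := ENNReal.ofReal (Real.exp (-(β * δ)) * (D * Real.exp (c + δ - B)) ^ N) with hR_def
  -- Uses `(β - N)(c + δ - B) = β(c - B) + βδ - N(c + δ - B)`.
  have hsplit : ENNReal.ofReal (Real.exp (-((β - N) * ((c + δ : ℝ≥0) - B)))) *
      ENNReal.ofReal D ^ N = ENNReal.ofReal (Real.exp (-(β * (c - B)))) * R := by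
    rw [hR_def, ← ENNReal.ofReal_pow hD, ← ENNReal.ofReal_mul (Real.exp_pos _).le,
      ← ENNReal.ofReal_mul (Real.exp_pos _).le, mul_pow, ← Real.exp_nat_mul]
    congr 1
    rw [show Real.exp (-(β * (c - B))) * (Real.exp (-(β * δ)) *
      (D ^ N * Real.exp (N * (c + δ - B)))) = (Real.exp (-(β * (c - B))) * Real.exp (-(β * δ)) *
      Real.exp (N * (c + δ - B))) * D ^ N by ring, ← Real.exp_add, ← Real.exp_add]
    congr 2
    push_cast
    ring
  have hMR : (M : ℝ≥0∞) ^ N * R ≤ 2⁻¹ ^ N := by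
    have h2 : (2⁻¹ : ℝ≥0∞) ^ N = ENNReal.ofReal ((1 / 2) ^ N) := by
      rw [ENNReal.ofReal_pow (by norm_num), one_div, ENNReal.ofReal_inv_of_pos two_pos,
        ENNReal.ofReal_ofNat]
    rw [h2, hR_def, ← ENNReal.ofReal_coe_nnreal, ← ENNReal.ofReal_pow M.coe_nonneg,
      ← ENNReal.ofReal_mul (by positivity)]
    refine ENNReal.ofReal_le_ofReal ?_
    refine le_trans (le_of_eq ?_) (exp_neg_mul_pow_le (by positivity) hβδ)
    simp only [mul_pow]
    ring
  rw [hsplit]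
  calc ENNReal.ofReal (Real.exp (-(β * (c - B)))) * R
      = κ⁻¹ * (κ * ENNReal.ofReal (Real.exp (-(β * (c - B))))) * R := by
        rw [← mul_assoc, ENNReal.inv_mul_cancel hκ0 hκtop, one_mul]
    _ ≤ κ⁻¹ * ((M : ℝ≥0∞) ^ N * Z) * R := by gcongr
    _ = Z * (κ⁻¹ * ((M : ℝ≥0∞) ^ N * R)) := by ring
    _ ≤ Z * (κ⁻¹ * 2⁻¹ ^ N) := by gcongr

lemma tsum_ne_top_of_eventually_le {u : ℕ → ℝ≥0∞} (hu1 : ∀ n, u n ≤ 1) {K : ℝ≥0∞} (hK : K ≠ ∞)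
    (hu : ∀ᶠ n in atTop, u n ≤ K * 2⁻¹ ^ n) : ∑' n, u n ≠ ∞ := by
  obtain ⟨n₀, hn₀⟩ := eventually_atTop.1 hu
  rw [← Summable.sum_add_tsum_nat_add' (k := n₀) ENNReal.summable]
  refine ENNReal.add_ne_top.2 ⟨?_, ?_⟩
  · exact (ENNReal.sum_lt_top.2 fun n _ => (hu1 n).trans_lt ENNReal.one_lt_top).ne
  · refine ne_top_of_le_ne_top (b := K * 2) (ENNReal.mul_ne_top hK (by simp)) ?_
    calc ∑' n, u (n + n₀) ≤ ∑' n : ℕ, K * 2⁻¹ ^ n := by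
          refine ENNReal.tsum_le_tsum fun n => (hn₀ _ (Nat.le_add_left _ _)).trans ?_
          gcongr K * ?_
          exact pow_le_pow_of_le_one zero_le (ENNReal.inv_le_one.2 (by norm_num))
            (Nat.le_add_right _ _)
      _ = K * 2 := by
          rw [ENNReal.tsum_mul_left, ENNReal.tsum_geometric, ENNReal.one_sub_inv_two, inv_inv]

/-- The first Borel-Cantelli lemma needs only the marginal laws, so no assumption on the joint law
enters. -/
lemma ae_eventually_shiftedHamiltonian_le {d : ℕ} {α : ℝ} {V : Rd d → ℝ} (hVm : Measurable V)
    {B : ℝ≥0} {β : ℕ → ℝ} {c δ : ℝ≥0} {K : ℝ≥0∞} (hK : K ≠ ∞)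
    (hgibbs : ∀ᶠ N in atTop, gibbsMeasure V (rieszInteraction α) (β N) N
        {x | ((c + δ : ℝ≥0) : ℝ≥0∞) ≤ shiftedHamiltonian α V B N x} ≤ K * 2⁻¹ ^ N)
    {Ω : Type*} [MeasurableSpace Ω] (P : Measure Ω) [IsProbabilityMeasure P]
    (X : (N : ℕ) → Ω → (Fin N → Rd d))
    (hX : ∀ᶠ N in atTop, HasLaw (X N) (gibbsMeasure V (rieszInteraction α) (β N) N) P) :
    ∀ᵐ ω ∂P, ∀ᶠ N in atTop, shiftedHamiltonian α V B N (X N ω) ≤ (c + δ : ℝ≥0) := by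
  have hsum : ∑' N, P {ω | ((c + δ : ℝ≥0) : ℝ≥0∞) ≤ shiftedHamiltonian α V B N (X N ω)} ≠ ∞ := by
    refine tsum_ne_top_of_eventually_le (fun _ => prob_le_one) hK ?_
    filter_upwards [hgibbs, hX] with N h1 h2
    have hmeas : MeasurableSet {x | ((c + δ : ℝ≥0) : ℝ≥0∞) ≤ shiftedHamiltonian α V B N x} :=
      measurableSet_le measurable_const (measurable_shiftedHamiltonian α hVm B N)
    rw [h2.measure_eq hmeas]
    exact h1
  filter_upwards [ae_eventually_notMem hsum] with ω hω
  filter_upwards [hω] with N hN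
  exact (not_le.1 hN).le

theorem gibbs_partition_and_convergence {d : ℕ} {α : ℝ} (hαd : α < d) {V : Rd d → ℝ}
    (hV : Confining V) {B : ℝ≥0} {C : ℝ} (hVB : ∀ x, 0 ≤ V x + B)
    (hVle : ∀ x, V x ≤ ‖x‖ ^ 2) (hVge : ∀ x, ‖x‖ ^ 2 ≤ V x + C)
    (μ : ProbabilityMeasure (Rd d)) (hμ : shiftedEnergy α V B (μ : Measure (Rd d)) ≠ ∞)
    (huniq : ∀ ν : ProbabilityMeasure (Rd d), shiftedEnergy α V B (ν : Measure (Rd d)) ≤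
      shiftedEnergy α V B (μ : Measure (Rd d)) → ν = μ)
    (β : ℕ → ℝ) (hβ : Tendsto (fun N : ℕ => β N / (N * Real.log N)) atTop atTop) :
    (∀ᶠ N in atTop, 0 < partitionFunction V (rieszInteraction α) (β N) N ∧
      partitionFunction V (rieszInteraction α) (β N) N < ∞) ∧
    ∀ (Ω : Type*) [MeasurableSpace Ω] (P : Measure Ω) [IsProbabilityMeasure P]
      (X : (N : ℕ) → Ω → (Fin N → Rd d)),
      (∀ᶠ N in atTop, HasLaw (X N) (gibbsMeasure V (rieszInteraction α) (β N) N) P) →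
      ∀ᵐ ω ∂P, Tendsto (fun N => empiricalMeasure (X N ω)) atTop (𝓝 μ.toFiniteMeasure) := by
  have hVm := hV.continuous.measurable
  have hβN : ∀ᶠ N : ℕ in atTop, (N : ℝ) ≤ β N := by
    simpa using eventually_mul_le_of_tendsto_div_log hβ 1
  obtain ⟨j, hj⟩ : ∃ j : ℝ≥0, (j : ℝ≥0∞) = shiftedEnergy α V B (μ : Measure (Rd d)) :=
    ⟨_, ENNReal.coe_toNNReal hμ⟩
  have key : ∀ δ : ℝ≥0, 0 < δ → ∃ K : ℝ≥0∞, K ≠ ∞ ∧ ∀ᶠ N : ℕ in atTop,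
      0 < partitionFunction V (rieszInteraction α) (β N) N ∧
      gibbsMeasure V (rieszInteraction α) (β N) N
        -- One `δ` is lost in approximating `μ` by a measure of bounded density, the other provides
        -- the exponential gain.
        {x | ((j + δ + δ : ℝ≥0) : ℝ≥0∞) ≤ shiftedHamiltonian α V B N x} ≤ K * 2⁻¹ ^ N := by
    intro δ hδ
    obtain ⟨νs, hM, -, hE⟩ :=
      exists_bounded_density_approximation hαd hV.continuous hVle hVge μ hμ
    have hlt : shiftedEnergy α V B (μ : Measure (Rd d)) < ((j + δ : ℝ≥0) : ℝ≥0∞) := by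
      rw [← hj]
      exact_mod_cast lt_add_of_pos_right j hδ
    obtain ⟨n, hn⟩ := (hE.eventually_lt_const hlt).exists
    obtain ⟨M, hηM⟩ := hM n
    refine ⟨(1 - shiftedEnergy α V B (νs n : Measure (Rd d)) / ((j + δ : ℝ≥0) : ℝ≥0∞))⁻¹,
      ENNReal.inv_ne_top.2 ?_, ?_⟩
    · rw [Ne, tsub_eq_zero_iff_le, not_le]
      exact ENNReal.div_lt_of_lt_mul (by simpa using hn)
    · have hδ' : (0 : ℝ) < δ := hδ
      filter_upwards [eventually_mul_le_of_tendsto_div_log hβ (Real.log (2 * (M *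
        (∫ x, Real.exp (-V x)) * Real.exp ((j + δ : ℝ≥0) + δ - B)) + 1) / δ), hβN,
        eventually_ne_atTop 0] with N h1 h2 h3
      refine gibbsMeasure_le hVm hVB hV.integrable_exp_neg hηM hn h3 h2 ?_
      rw [div_mul_eq_mul_div, div_le_iff₀ hδ'] at h1
      exact h1
  refine ⟨?_, fun Ω _ P _ X hX => ?_⟩
  · obtain ⟨K, -, h⟩ := key 1 one_pos
    filter_upwards [h, hβN, eventually_ne_atTop 0] with N h1 h2 h3
    exact ⟨h1.1, partitionFunction_lt_top hVm hVB hV.integrable_exp_neg h3 h2⟩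
  -- Only countably many thresholds are used, so that the exceptional null sets can be united.
  · have hae : ∀ k : ℕ, ∀ᵐ ω ∂P, ∀ᶠ N in atTop, shiftedHamiltonian α V B N (X N ω) ≤
        ((j + 1 / ((k : ℝ≥0) + 1) + 1 / ((k : ℝ≥0) + 1) : ℝ≥0) : ℝ≥0∞) := by
      intro k
      obtain ⟨K, hK, h⟩ := key (1 / ((k : ℝ≥0) + 1)) (by positivity)
      exact ae_eventually_shiftedHamiltonian_le hVm hK (h.mono fun N hN => hN.2) P X hX
    filter_upwards [ae_all_iff.2 hae] with ω hω
    refine tendsto_empiricalMeasure_of_shiftedHamiltonian_le hV.continuous hV.tendsto_atTop μ hμ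
      huniq (fun N => X N ω) fun δ hδ => ?_
    obtain ⟨k, hk⟩ := exists_nat_one_div_lt (show (0 : ℝ) < δ / 2 by
      have : (0 : ℝ) < δ := hδ
      positivity)
    filter_upwards [hω k] with N hN
    refine hN.trans ?_
    rw [← hj, ← ENNReal.coe_add, ENNReal.coe_le_coe, ← NNReal.coe_le_coe]
    push_cast
    linarith

end RieszGas

end

/-! ### Assembly of the conclusions -/

theorem corollary1p4 {d : ℕ} (α : ℝ) (hα : 0 < α) (hαd : α < d)
    (μ : ProbabilityMeasure (RieszGas.Rd d))
    -- `f` is a density of `μ` in `L^p`, where `d / α < p ≤ ∞`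
    (p : ℝ≥0∞) (hp : ENNReal.ofReal ((d : ℝ) / α) < p)
    (f : RieszGas.Rd d → ℝ) (hf_nonneg : 0 ≤ᵐ[volume] f) (hf : MemLp f p volume)
    (hμf : (μ : Measure (RieszGas.Rd d)) = volume.withDensity (fun x => ENNReal.ofReal (f x)))
    -- the support of `μ` is compact, being contained in the closed ball of radius `R`
    (R : ℝ) (hR : 0 < R)
    (hsupp : (μ : Measure (RieszGas.Rd d)).support ⊆ Metric.closedBall 0 R)
    (V : RieszGas.Rd d → ℝ) (hV : V = RieszGas.prescribingPotential α R μ)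
    (W : RieszGas.Rd d → RieszGas.Rd d → EReal) (hW : W = RieszGas.rieszInteraction α) :
    -- the potential of `μ` is finite everywhere, so that `V` is real-valued
    (∀ x, RieszGas.rieszPotential α (μ : Measure (RieszGas.Rd d)) x < ∞) ∧
    -- the four assumptions on `(V, W)`
    RieszGas.InteractionRegular W ∧
    RieszGas.Confining V ∧
    RieszGas.Dominates V W ∧
    RieszGas.EnergyApproximable V W ∧
    -- the energy takes values in `ℝ ∪ {+∞}`, and `μ` is its unique minimizer
    (∀ ν, RieszGas.rieszEnergy α V ν ≠ ⊥ ∧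
      RieszGas.rieszEnergy α V ν = RieszGas.energy V W ν) ∧
    (∀ ν, RieszGas.rieszEnergy α V μ ≤ RieszGas.rieszEnergy α V ν) ∧
    (∀ ν, (∀ ρ, RieszGas.rieszEnergy α V ν ≤ RieszGas.rieszEnergy α V ρ) → ν = μ) ∧
    -- almost sure convergence of the empirical measures when `β_N ≫ N log N`
    (∀ β : ℕ → ℝ, Tendsto (fun N : ℕ => β N / (N * Real.log N)) atTop atTop →
      (∀ᶠ N in atTop, 0 < RieszGas.partitionFunction V W (β N) N ∧
        RieszGas.partitionFunction V W (β N) N < ∞) ∧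
      ∀ (Ω : Type*) [MeasurableSpace Ω] (P : Measure Ω) [IsProbabilityMeasure P]
        (X : (N : ℕ) → Ω → (Fin N → RieszGas.Rd d)),
        (∀ᶠ N in atTop, HasLaw (X N) (RieszGas.gibbsMeasure V W (β N) N) P) →
        ∀ᵐ ω ∂P, Tendsto (fun N => RieszGas.empiricalMeasure (X N ω)) atTop
          (𝓝 μ.toFiniteMeasure)) := by
  subst hV hW
  obtain ⟨⟨B, hB⟩, hUc⟩ := RieszGas.rieszPotential_bounded_continuous hα hαd
    (μ : Measure (RieszGas.Rd d)) hp hf hμf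
  have hconf := RieszGas.confining_prescribingPotential (R := R) hB hUc
  have hVB := RieszGas.prescribingPotential_add_nonneg (R := R) hB
  have hVge := RieszGas.norm_sq_le_prescribingPotential (R := R) hB
  have hVle : ∀ x, RieszGas.prescribingPotential α R (μ : Measure (RieszGas.Rd d)) x ≤ ‖x‖ ^ 2 :=
    RieszGas.prescribingPotential_le_norm_sq
  have hVm := hconf.continuous.measurable
  have hE := RieszGas.rieszEnergy_eq_shiftedEnergy α hVm hVB
  have huniq : ∀ ν : ProbabilityMeasure (RieszGas.Rd d),
      RieszGas.shiftedEnergy α (RieszGas.prescribingPotential α R (μ : Measure (RieszGas.Rd d))) B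
          (ν : Measure (RieszGas.Rd d)) ≤
        RieszGas.shiftedEnergy α (RieszGas.prescribingPotential α R (μ : Measure (RieszGas.Rd d))) B
          (μ : Measure (RieszGas.Rd d)) → ν = μ := by
    intro ν h
    exact Subtype.ext (RieszGas.eq_of_shiftedEnergy_le hαd hB hsupp
      (ν : Measure (RieszGas.Rd d)) h)
  refine ⟨fun x => (hB x).trans_lt ENNReal.coe_lt_top,
    RieszGas.interactionRegular_rieszInteraction hα hαd, hconf,
    RieszGas.dominates_prescribingPotential hB,
    RieszGas.energyApproximable_of_quadratic hαd hconf.continuous hVB hVle hVge,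
    fun ν => ⟨?_, ?_⟩, fun ν => ?_, fun ν hν => huniq ν ?_, fun β hβ => ?_⟩
  · rw [hE ν, sub_eq_add_neg, Ne, EReal.add_eq_bot_iff, not_or]
    exact ⟨EReal.coe_ennreal_ne_bot _, EReal.coe_ne_bot (-(B : ℝ))⟩
  · rw [hE ν, RieszGas.energy_eq_shiftedEnergy α hVm hVB]
  · rw [hE μ, hE ν, RieszGas.coe_sub_coe_le_iff]
    exact RieszGas.shiftedEnergy_min hαd hB hsupp (ν : Measure (RieszGas.Rd d))
  · have h := hν μ
    rwa [hE μ, hE ν, RieszGas.coe_sub_coe_le_iff] at h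
  · exact RieszGas.gibbs_partition_and_convergence hαd hconf hVB hVle hVge μ
      (RieszGas.shiftedEnergy_ne_top hB hsupp) huniq β hβ
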